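/- Let $A,B,C,D\in C^2(\mathbb R^5)$ be functions of $(x,y,z,p,q)$, put $\Delta^2=C^2-4BD+4A$ and, where $\Delta^2>0$, let $\Delta>0$ be its positive root. Consider the Cauchy problem for the hyperbolic Monge–Ampère equation $$A+Bz_{xx}+Cz_{xy}+Dz_{yy}+z_{xx}z_{yy}-z_{xy}^2=0,\qquad \Delta^2(x,y,z,z_x,z_y)>0,\qquad z(0,y)=z_0(y),\quad z_x(0,y)=p_0(y),\tag{1}$$ with coefficients taken at $(x,y,z,z_x,z_y)$, where $z_0\in C^3(\mathbb R)$, $p_0\in C^2(\mathbb R)$, and for all $y\in\mathbb R$, with $w_0(y)=(0,y,z_0(y),p_0(y),z_0'(y))$, $$z_0''(y)+B(w_0(y))\ne 0,\qquad \Delta^2(w_0(y))>0 .$$ Consider also the system for $(u_1,u_2,z,p,q)$, with coefficients taken at $(x,y,z,p,q)$ (where $z,p,q$ are functions of $(x,y)$), $$\begin{aligned} u_{1x}+u_2u_{1y}&=E_0+E_1u_1+E_2u_2+E_3u_1^2+E_4u_1u_2+E_5u_1^2u_2,\\ u_{2x}+u_1u_{2y}&=I_0+I_1u_1+I_2u_2+I_3u_2^2+I_4u_1u_2+I_5u_1u_2^2,\\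 z_x+u_1z_y&=p+u_1q,\\ p_x+u_2p_y&=\tfrac{C+\Delta}{2}u_2-D,\\ q_x+u_1q_y&=\tfrac{C+\Delta}{2}-Bu_1, \end{aligned}\tag{2}$$ where subscripts $x,y,z,p,q$ on $B,C,D,\Delta$ denote partial derivatives on $\mathbb R^5$, and $E_0=I_0=D_q$, $E_5=I_5=-B_p$, $$\begin{aligned} E_1&=\alpha_1+\alpha_2+\tfrac1{4\Delta}(CC_q-3\Delta C_q+C\Delta_q+\Delta\Delta_q-2\Delta D_p),\\ E_2&=-\alpha_1-\alpha_2+\tfrac1{4\Delta}(-CC_q-\Delta C_q-C\Delta_q-\Delta\Delta_q-2\Delta D_p),\\ E_3&=-\beta_1+\beta_2+\tfrac1{4\Delta}(-CC_p+\Delta C_p+C\Delta_p-\Delta\Delta_p+2\Delta B_q),\\ E_4&=\beta_1-\beta_2+\tfrac1{4\Delta}(CC_p+3\Delta C_p-C\Delta_p+\Delta\Delta_p+2\Delta B_q),\\ I_1&=\alpha_1-\alpha_2+\tfrac1{4\Delta}(CC_q-\Delta C_q-C\Delta_q+\Delta\Delta_q-2\Delta D_p),\\ I_2&=-\alpha_1+\alpha_2+\tfrac1{4\Delta}(-CC_q-3\Delta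 C_q+C\Delta_q-\Delta\Delta_q-2\Delta D_p),\\ I_3&=\beta_1+\beta_2+\tfrac1{4\Delta}(CC_p+\Delta C_p+C\Delta_p+\Delta\Delta_p+2\Delta B_q),\\ I_4&=-\beta_1-\beta_2+\tfrac1{4\Delta}(-CC_p+3\Delta C_p-C\Delta_p-\Delta\Delta_p+2\Delta B_q),\\ \alpha_1&=\tfrac1{2\Delta}(2D_y+C_x+2D_zq+C_zp+CD_p-DC_p-2BD_q),\qquad \alpha_2=\tfrac1{2\Delta}(\Delta_x+\Delta_zp-D\Delta_p),\\ \beta_1&=\tfrac1{2\Delta}(2B_x+C_y+2B_zp+C_zq+CB_q-BC_q-2DB_p),\qquad \beta_2=\tfrac1{2\Delta}(\Delta_y+\Delta_zq-B\Delta_q). \end{aligned}$$ Let $T\subset\mathbb R^2$ be a domain (a connected open set) with $T\cap\{x=0\}\ne\varnothing$, and let $(u_1,u_2,z,p,q)$ be a $C^1$ solution of (2) on $T$ such that $\Delta^2(x,y,z(x,y),p(x,y),q(x,y))>0$ on $T$, and such that for all $y$ with $(0,y)\in T$ $$z(0,y)=z_0(y),\quad p(0,y)=p_0(y),\quad q(0,y)=z_0'(y),\quad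 u_{1}(0,y)=\frac{(C+\Delta)(w_0(y))-2p_0'(y)}{2\left(z_0''(y)+B(w_0(y))\right)},\quad u_{2}(0,y)=\frac{(C-\Delta)(w_0(y))-2p_0'(y)}{2\left(z_0''(y)+B(w_0(y))\right)} .$$ Suppose that $T$ is a domain of determinacy of this solution: for each $(x,y)\in T$ and $i=1,2$, the problem $dg/d\tau=u_i(\tau,g)$, $g(x)=y$, has a solution $g$ on the closed interval between $0$ and $x$ with $(\tau,g(\tau))\in T$ for all $\tau$ in that interval. Then $z\in C^3(T)$ is a solution of (1) on $T$ (the initial conditions holding for all $y$ with $(0,y)\in T$), and on $T$ $$z_x=p,\qquad z_y=q,\qquad u_1\ne u_2,\qquad z_{yy}+B(x,y,z,z_x,z_y)\ne0 .$$ The last inequality says that the vertical lines $x=\mathrm{const}$ are free. -/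

import Mathlib

noncomputable section

namespace MongeAmpere

/-- The point `(x, y, z, p, q)` of `ℝ⁵`. -/
def pt (x y z p q : ℝ) : Fin 5 → ℝ := ![x, y, z, p, q]

/-- The partial derivative of `F : ℝ⁵ → ℝ` in its `i`-th argument;
the arguments are numbered `0 ↔ x`, `1 ↔ y`, `2 ↔ z`, `3 ↔ p`, `4 ↔ q`. -/
def pd (i : Fin 5) (F : (Fin 5 → ℝ) → ℝ) (w : Fin 5 → ℝ) : ℝ :=
  fderiv ℝ F w (Pi.single i 1)

/-- The partial derivative `f_x` of a function of `(x, y)`. -/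
def dx (f : ℝ × ℝ → ℝ) (P : ℝ × ℝ) : ℝ := fderiv ℝ f P (1, 0)

/-- The partial derivative `f_y` of a function of `(x, y)`. -/
def dy (f : ℝ × ℝ → ℝ) (P : ℝ × ℝ) : ℝ := fderiv ℝ f P (0, 1)

/-- The coefficients of the equation
`A + B z_xx + C z_xy + D z_yy + (z_xx z_yy - z_xy²) = 0`,
as functions of `(x, y, z, p, q)` with `p = z_x`, `q = z_y`. -/
structure Coeffs where
  A : (Fin 5 → ℝ) → ℝ
  B : (Fin 5 → ℝ) → ℝ
  C : (Fin 5 → ℝ) → ℝ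
  D : (Fin 5 → ℝ) → ℝ

namespace Coeffs

variable (c : Coeffs)

/-- All coefficients are twice continuously differentiable on `ℝ⁵`. -/
def IsC2 : Prop :=
  ContDiff ℝ 2 c.A ∧ ContDiff ℝ 2 c.B ∧ ContDiff ℝ 2 c.C ∧ ContDiff ℝ 2 c.D

/-- The discriminant `Δ² = C² - 4BD + 4A`. -/
def disc (w : Fin 5 → ℝ) : ℝ := c.C w ^ 2 - 4 * c.B w * c.D w + 4 * c.A w

/-- `Δ`, the nonnegative root of the discriminant; `Δ w > 0` holds iff `disc w > 0`. -/
def Delta (w : Fin 5 → ℝ) : ℝ := Real.sqrt (c.disc w)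

def alpha1 (w : Fin 5 → ℝ) : ℝ :=
  1 / (2 * c.Delta w) *
    (2 * pd 1 c.D w + pd 0 c.C w + 2 * pd 2 c.D w * w 4 + pd 2 c.C w * w 3
      + c.C w * pd 3 c.D w - c.D w * pd 3 c.C w - 2 * c.B w * pd 4 c.D w)

def alpha2 (w : Fin 5 → ℝ) : ℝ :=
  1 / (2 * c.Delta w) *
    (pd 0 c.Delta w + pd 2 c.Delta w * w 3 - c.D w * pd 3 c.Delta w)

def beta1 (w : Fin 5 → ℝ) : ℝ :=
  1 / (2 * c.Delta w) *
    (2 * pd 0 c.B w + pd 1 c.C w + 2 * pd 2 c.B w * w 3 + pd 2 c.C w * w 4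
      + c.C w * pd 4 c.B w - c.B w * pd 4 c.C w - 2 * c.D w * pd 3 c.B w)

def beta2 (w : Fin 5 → ℝ) : ℝ :=
  1 / (2 * c.Delta w) *
    (pd 1 c.Delta w + pd 2 c.Delta w * w 4 - c.B w * pd 4 c.Delta w)

/-- `E₀ = I₀ = D_q`. -/
def E0 (w : Fin 5 → ℝ) : ℝ := pd 4 c.D w

/-- `E₅ = I₅ = -B_p`. -/
def E5 (w : Fin 5 → ℝ) : ℝ := - pd 3 c.B w

def E1 (w : Fin 5 → ℝ) : ℝ :=
  c.alpha1 w + c.alpha2 w + 1 / (4 * c.Delta w) *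
    (c.C w * pd 4 c.C w - 3 * c.Delta w * pd 4 c.C w + c.C w * pd 4 c.Delta w
      + c.Delta w * pd 4 c.Delta w - 2 * c.Delta w * pd 3 c.D w)

def E2 (w : Fin 5 → ℝ) : ℝ :=
  - c.alpha1 w - c.alpha2 w + 1 / (4 * c.Delta w) *
    (- c.C w * pd 4 c.C w - c.Delta w * pd 4 c.C w - c.C w * pd 4 c.Delta w
      - c.Delta w * pd 4 c.Delta w - 2 * c.Delta w * pd 3 c.D w)

def E3 (w : Fin 5 → ℝ) : ℝ :=
  - c.beta1 w + c.beta2 w + 1 / (4 * c.Delta w) *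
    (- c.C w * pd 3 c.C w + c.Delta w * pd 3 c.C w + c.C w * pd 3 c.Delta w
      - c.Delta w * pd 3 c.Delta w + 2 * c.Delta w * pd 4 c.B w)

def E4 (w : Fin 5 → ℝ) : ℝ :=
  c.beta1 w - c.beta2 w + 1 / (4 * c.Delta w) *
    (c.C w * pd 3 c.C w + 3 * c.Delta w * pd 3 c.C w - c.C w * pd 3 c.Delta w
      + c.Delta w * pd 3 c.Delta w + 2 * c.Delta w * pd 4 c.B w)

def I1 (w : Fin 5 → ℝ) : ℝ :=
  c.alpha1 w - c.alpha2 w + 1 / (4 * c.Delta w) *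
    (c.C w * pd 4 c.C w - c.Delta w * pd 4 c.C w - c.C w * pd 4 c.Delta w
      + c.Delta w * pd 4 c.Delta w - 2 * c.Delta w * pd 3 c.D w)

def I2 (w : Fin 5 → ℝ) : ℝ :=
  - c.alpha1 w + c.alpha2 w + 1 / (4 * c.Delta w) *
    (- c.C w * pd 4 c.C w - 3 * c.Delta w * pd 4 c.C w + c.C w * pd 4 c.Delta w
      - c.Delta w * pd 4 c.Delta w - 2 * c.Delta w * pd 3 c.D w)

def I3 (w : Fin 5 → ℝ) : ℝ :=
  c.beta1 w + c.beta2 w + 1 / (4 * c.Delta w) *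
    (c.C w * pd 3 c.C w + c.Delta w * pd 3 c.C w + c.C w * pd 3 c.Delta w
      + c.Delta w * pd 3 c.Delta w + 2 * c.Delta w * pd 4 c.B w)

def I4 (w : Fin 5 → ℝ) : ℝ :=
  - c.beta1 w - c.beta2 w + 1 / (4 * c.Delta w) *
    (- c.C w * pd 3 c.C w + 3 * c.Delta w * pd 3 c.C w - c.C w * pd 3 c.Delta w
      - c.Delta w * pd 3 c.Delta w + 2 * c.Delta w * pd 4 c.B w)

/-- `(u₁, u₂, z, p, q)` is a `C¹` solution on `T` of the system of five first order equations
in Riemann invariants; all coefficients are taken at `(x, y, z(x,y), p(x,y), q(x,y))`. -/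
structure IsRiemannSolution (T : Set (ℝ × ℝ)) (u₁ u₂ z p q : ℝ × ℝ → ℝ) : Prop where
  contDiffOn_u₁ : ContDiffOn ℝ 1 u₁ T
  contDiffOn_u₂ : ContDiffOn ℝ 1 u₂ T
  contDiffOn_z : ContDiffOn ℝ 1 z T
  contDiffOn_p : ContDiffOn ℝ 1 p T
  contDiffOn_q : ContDiffOn ℝ 1 q T
  eq_u₁ : ∀ P ∈ T, ∀ w, w = pt P.1 P.2 (z P) (p P) (q P) →
    dx u₁ P + u₂ P * dy u₁ P =
      c.E0 w + c.E1 w * u₁ P + c.E2 w * u₂ P + c.E3 w * u₁ P ^ 2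
        + c.E4 w * u₁ P * u₂ P + c.E5 w * u₁ P ^ 2 * u₂ P
  eq_u₂ : ∀ P ∈ T, ∀ w, w = pt P.1 P.2 (z P) (p P) (q P) →
    dx u₂ P + u₁ P * dy u₂ P =
      c.E0 w + c.I1 w * u₁ P + c.I2 w * u₂ P + c.I3 w * u₂ P ^ 2
        + c.I4 w * u₁ P * u₂ P + c.E5 w * u₁ P * u₂ P ^ 2
  eq_z : ∀ P ∈ T, dx z P + u₁ P * dy z P = p P + u₁ P * q P
  eq_p : ∀ P ∈ T, ∀ w, w = pt P.1 P.2 (z P) (p P) (q P) →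
    dx p P + u₂ P * dy p P = (c.C w + c.Delta w) / 2 * u₂ P - c.D w
  eq_q : ∀ P ∈ T, ∀ w, w = pt P.1 P.2 (z P) (p P) (q P) →
    dx q P + u₁ P * dy q P = (c.C w + c.Delta w) / 2 - c.B w * u₁ P

/-- The point `(0, y, z₀(y), p₀(y), z₀'(y))` of `ℝ⁵`. -/
def initPt (z₀ p₀ : ℝ → ℝ) (y : ℝ) : Fin 5 → ℝ := pt 0 y (z₀ y) (p₀ y) (deriv z₀ y)

/-- The admissible Cauchy data on the axis `x = 0`: `z₀ ∈ C³(ℝ)`, `p₀ ∈ C²(ℝ)`, the axis is free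
and the equation is hyperbolic along it. -/
structure IsCauchyData (z₀ p₀ : ℝ → ℝ) : Prop where
  contDiff_z₀ : ContDiff ℝ 3 z₀
  contDiff_p₀ : ContDiff ℝ 2 p₀
  free : ∀ y, deriv (deriv z₀) y + c.B (initPt z₀ p₀ y) ≠ 0
  hyperbolic : ∀ y, 0 < c.disc (initPt z₀ p₀ y)

/-- The initial values of `(u₁, u₂, z, p, q)` on the part of the axis `x = 0` lying in `T`. -/
structure HasInitialValues (z₀ p₀ : ℝ → ℝ) (T : Set (ℝ × ℝ))
    (u₁ u₂ z p q : ℝ × ℝ → ℝ) : Prop where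
  z_eq : ∀ y, (0, y) ∈ T → z (0, y) = z₀ y
  p_eq : ∀ y, (0, y) ∈ T → p (0, y) = p₀ y
  q_eq : ∀ y, (0, y) ∈ T → q (0, y) = deriv z₀ y
  u₁_eq : ∀ y, (0, y) ∈ T → u₁ (0, y) =
    (c.C (initPt z₀ p₀ y) + c.Delta (initPt z₀ p₀ y) - 2 * deriv p₀ y) /
      (2 * (deriv (deriv z₀) y + c.B (initPt z₀ p₀ y)))
  u₂_eq : ∀ y, (0, y) ∈ T → u₂ (0, y) =
    (c.C (initPt z₀ p₀ y) - c.Delta (initPt z₀ p₀ y) - 2 * deriv p₀ y) /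
      (2 * (deriv (deriv z₀) y + c.B (initPt z₀ p₀ y)))

/-- `z` is a `C³` solution on `T` of the Cauchy problem for the hyperbolic Monge–Ampère equation:
it is of class `C³`, satisfies the equation, the equation is hyperbolic on `z`, and `z` and `z_x`
take the prescribed values on the part of the axis `x = 0` lying in `T`. -/
structure IsCauchySolution (z₀ p₀ : ℝ → ℝ) (T : Set (ℝ × ℝ)) (z : ℝ × ℝ → ℝ) : Prop where
  contDiffOn : ContDiffOn ℝ 3 z T
  equation : ∀ P ∈ T, ∀ w, w = pt P.1 P.2 (z P) (dx z P) (dy z P) →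
    c.A w + c.B w * dx (dx z) P + c.C w * dy (dx z) P + c.D w * dy (dy z) P
      + (dx (dx z) P * dy (dy z) P - dy (dx z) P ^ 2) = 0
  hyperbolic : ∀ P ∈ T, 0 < c.disc (pt P.1 P.2 (z P) (dx z P) (dy z P))
  z_init : ∀ y, (0, y) ∈ T → z (0, y) = z₀ y
  zx_init : ∀ y, (0, y) ∈ T → dx z (0, y) = p₀ y

end Coeffs

/-- Every integral curve of `dg/dτ = ξ(τ, g)` through a point of `T` extends to the axis `x = 0`
inside `T`: for `(x, y) ∈ T` there is a solution `g` on the closed interval between `0` and `x`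
with `g(x) = y` and `(τ, g(τ)) ∈ T`. -/
def CharacteristicsReachAxis (T : Set (ℝ × ℝ)) (ξ : ℝ × ℝ → ℝ) : Prop :=
  ∀ x y : ℝ, (x, y) ∈ T → ∃ g : ℝ → ℝ, g x = y ∧
    ∀ τ ∈ Set.uIcc 0 x, (τ, g τ) ∈ T ∧ HasDerivWithinAt g (ξ (τ, g τ)) (Set.uIcc 0 x) τ

/-- `T` is a domain of determinacy for the system, whose characteristics have the slopes `u₁` and
`u₂`: both characteristics through each point of `T` reach the axis `x = 0` inside `T`. -/
def IsDomainOfDeterminacy (T : Set (ℝ × ℝ)) (u₁ u₂ : ℝ × ℝ → ℝ) : Prop :=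
  CharacteristicsReachAxis T u₁ ∧ CharacteristicsReachAxis T u₂

end MongeAmpere

end

/-!
Along the characteristics of slope `u₁` and `u₂` a solution of the Monge–Ampère equation satisfies
more relations than the five equations of the system, which contain only one relation for each of
`z`, `p`, `q`. The missing ones are `z_y = q`, `(u₁ - u₂) (q_y + B) = Δ` and
`(u₁ - u₂) p_y = (C - Δ) / 2 u₁ - (C + Δ) / 2 u₂`; the differences of their sides are the *defects*
`defectZ`, `Coeffs.defectQ`, `Coeffs.defectP`. The initial values are chosen so that the defects
vanish on the axis (`Coeffs.defects_axis`), and the theorem amounts to their vanishing on `T`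
(`Coeffs.defects_eq_zero`). Indeed, the relations express all first derivatives of `p` and `q`
through `u₁`, `u₂`, `z`, `p`, `q`, which makes `p` and `q` of class `C²` and `z` of class `C³`; the
Monge–Ampère equation is then an algebraic identity (`Coeffs.equation_of_slopes`), and
`(u₁ - u₂) (z_yy + B) = Δ > 0` makes both factors nonzero.

The right-hand sides of the equations for `u₁` and `u₂` agree where `u₁ = u₂`, so `u₁ - u₂` solves a
linear homogeneous equation along the characteristics of slope `u₁`; it does not vanish on the axis,
hence vanishes nowhere (`Coeffs.IsRiemannSolution.slopes_ne`).

The defects satisfy a linear homogeneous system: `defectZ` and `defectQ` have derivatives along the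
characteristics of slope `u₁`, and `defectP` along those of slope `u₂`, which are linear
combinations of the three defects with continuous coefficients. This is where the precise form of
the coefficients of the system enters (`Coeffs.defect_identity₁`, `Coeffs.defect_identity₂`). The
defects contain first derivatives of `C¹` functions and are only continuous; that they are
differentiable along characteristics, with the derivatives computed formally, is
`hasDerivWithinAt_dy_along`.

Such a system has only the zero solution on a domain of determinacy (`eq_zero_of_isTransported`).
The two characteristics through a point and the axis bound a compact triangle which lies in `T` and
is invariant under both families of characteristics (`exists_triangle`). On it the maximum of the
defects, weighted by an exponential in `x`, is at most half of itself.
-/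

namespace MongeAmpere

open Set Filter Topology

/-! ### Calculus on open subsets of the plane -/

section Calculus

variable {T : Set (ℝ × ℝ)} {f : ℝ × ℝ → ℝ}

lemma differentiableAt_of_contDiffOn {n : WithTop ℕ∞} (hT : IsOpen T) (hf : ContDiffOn ℝ n f T)
    (hn : n ≠ 0) {P : ℝ × ℝ} (hP : P ∈ T) : DifferentiableAt ℝ f P :=
  (hf.contDiffAt (hT.mem_nhds hP)).differentiableAt hn

lemma contDiffOn_dy {n : WithTop ℕ∞} (hT : IsOpen T) (hf : ContDiffOn ℝ (n + 1) f T) :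
    ContDiffOn ℝ n (dy f) T :=
  (hf.fderiv_of_isOpen hT le_rfl).clm_apply contDiffOn_const

lemma continuousOn_dy (hT : IsOpen T) (hf : ContDiffOn ℝ 1 f T) : ContinuousOn (dy f) T :=
  (contDiffOn_dy (n := 0) hT (by simpa using hf)).continuousOn

lemma fderiv_apply_eq_dx_dy (f : ℝ × ℝ → ℝ) (P v : ℝ × ℝ) :
    fderiv ℝ f P v = v.1 * dx f P + v.2 * dy f P := by
  have : v = v.1 • ((1, 0) : ℝ × ℝ) + v.2 • ((0, 1) : ℝ × ℝ) := by ext <;> simp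
  conv_lhs => rw [this]
  simp only [map_add, map_smul, smul_eq_mul, dx, dy]

/-- A function whose two partial derivatives are of class `Cⁿ` is of class `Cⁿ⁺¹`. -/
lemma contDiffOn_succ_of_dx_dy (hT : IsOpen T) {n : ℕ} {a b : ℝ × ℝ → ℝ}
    (hf : ∀ P ∈ T, DifferentiableAt ℝ f P) (ha : ContDiffOn ℝ n a T) (hb : ContDiffOn ℝ n b T)
    (hfa : ∀ P ∈ T, dx f P = a P) (hfb : ∀ P ∈ T, dy f P = b P) :
    ContDiffOn ℝ (n + 1) f T := by
  rw [contDiffOn_succ_iff_fderiv_of_isOpen hT]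
  refine ⟨fun P hP => (hf P hP).differentiableWithinAt, by simp, ?_⟩
  have : ContDiffOn ℝ n (fun P => a P • ContinuousLinearMap.fst ℝ ℝ ℝ
      + b P • ContinuousLinearMap.snd ℝ ℝ ℝ) T :=
    (ha.smul contDiffOn_const).add (hb.smul contDiffOn_const)
  refine this.congr fun P hP => ?_
  ext <;> simp [fderiv_apply_eq_dx_dy, hfa P hP, hfb P hP]

/-- The chain rule along the graph of a function of `x`. -/
lemma hasDerivWithinAt_along {g : ℝ → ℝ} {s : Set ℝ} {t v : ℝ}
    (hf : DifferentiableAt ℝ f (t, g t)) (hg : HasDerivWithinAt g v s t) :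
    HasDerivWithinAt (fun r => f (r, g r)) (dx f (t, g t) + v * dy f (t, g t)) s t := by
  have h := hf.hasFDerivAt.comp_hasDerivWithinAt t ((hasDerivWithinAt_id t s).prodMk hg)
  simp only [fderiv_apply_eq_dx_dy, one_mul] at h
  exact h

lemma hasDerivAt_dy {P : ℝ × ℝ} (hf : DifferentiableAt ℝ f P) :
    HasDerivAt (fun y => f (P.1, y)) (dy f P) P.2 := by
  have h := (show HasFDerivAt f (fderiv ℝ f P) (P.1, P.2) from hf.hasFDerivAt).comp_hasDerivAt P.2
    ((hasDerivAt_const P.2 P.1).prodMk (hasDerivAt_id P.2))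
  exact h

end Calculus

/-! ### Characteristic curves -/

/-- `g` is a characteristic of slope `u` over `[a, b]` inside `T`: its graph lies in `T` and
`g' = u(·, g)` on `[a, b]`, with one-sided derivatives at the end points. -/
def IsChar (T : Set (ℝ × ℝ)) (u : ℝ × ℝ → ℝ) (a b : ℝ) (g : ℝ → ℝ) : Prop :=
  ∀ t ∈ Icc a b, (t, g t) ∈ T ∧ HasDerivWithinAt g (u (t, g t)) (Icc a b) t

section Char

variable {T : Set (ℝ × ℝ)} {u : ℝ × ℝ → ℝ} {a b : ℝ} {g h : ℝ → ℝ}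

lemma IsChar.continuousOn (hg : IsChar T u a b g) : ContinuousOn g (Icc a b) :=
  fun t ht => (hg t ht).2.continuousWithinAt

lemma IsChar.mono (hg : IsChar T u a b g) {a' b' : ℝ} (ha : a ≤ a') (hb : b' ≤ b) :
    IsChar T u a' b' g := fun t ht =>
  have ht' := Icc_subset_Icc ha hb ht
  ⟨(hg t ht').1, (hg t ht').2.mono (Icc_subset_Icc ha hb)⟩

lemma hasDerivWithinAt_Ici_of_Icc {E : Type*} [NormedAddCommGroup E] [NormedSpace ℝ E]
    {f : ℝ → E} {f' : E} {t : ℝ}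
    (hf : HasDerivWithinAt f f' (Icc a b) t) (ht : t ∈ Ico a b) :
    HasDerivWithinAt f f' (Ici t) t :=
  hf.mono_of_mem_nhdsWithin (mem_of_superset (Icc_mem_nhdsGE ht.2) (Icc_subset_Icc_left ht.1))

/-- The graph of a continuous function inside the open set `T` has a closed vertical tube around
it which stays in `T` and on which a given continuous function is bounded. -/
lemma exists_tube (hT : IsOpen T) {F : ℝ × ℝ → ℝ} (hF : ContinuousOn F T)
    (hg : ContinuousOn g (Icc a b)) (hgT : ∀ t ∈ Icc a b, (t, g t) ∈ T) :
    ∃ ρ > 0, ∃ M ≥ 0, ∀ t ∈ Icc a b, ∀ y, |y - g t| ≤ ρ → (t, y) ∈ T ∧ |F (t, y)| ≤ M := by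
  have hK : IsCompact ((fun t => (t, g t)) '' Icc a b) :=
    isCompact_Icc.image_of_continuousOn (continuousOn_id.prodMk hg)
  obtain ⟨ρ, hρ, hsub⟩ := hK.exists_cthickening_subset_open hT
    (by rintro _ ⟨t, ht, rfl⟩; exact hgT t ht)
  obtain ⟨M, hM⟩ := hK.cthickening.exists_bound_of_continuousOn (hF.mono hsub)
  refine ⟨ρ, hρ, max M 0, le_max_right _ _, fun t ht y hy => ?_⟩
  have hmem : (t, y) ∈ Metric.cthickening ρ ((fun t => (t, g t)) '' Icc a b) := by
    refine Metric.mem_cthickening_of_dist_le _ (t, g t) ρ _ ⟨t, ht, rfl⟩ ?_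
    simpa [Prod.dist_eq, Real.dist_eq, hρ.le] using hy
  exact ⟨hsub hmem, (hM _ hmem).trans (le_max_left _ _)⟩

/-- On a vertical segment inside `T` the increments of `f` are controlled by `f_y`. -/
lemma abs_sub_le_of_dy_le (hT : IsOpen T) {f : ℝ × ℝ → ℝ} (hf : ContDiffOn ℝ 1 f T)
    {t y₀ ρ M : ℝ} (hseg : ∀ y, |y - y₀| ≤ ρ → (t, y) ∈ T ∧ |dy f (t, y)| ≤ M)
    {y : ℝ} (hy : |y - y₀| ≤ ρ) : |f (t, y) - f (t, y₀)| ≤ M * |y - y₀| := by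
  have hmem : ∀ s ∈ Metric.closedBall y₀ ρ, (t, s) ∈ T ∧ |dy f (t, s)| ≤ M := fun s hs =>
    hseg s (by simpa [Real.dist_eq] using hs)
  refine (convex_closedBall y₀ ρ).norm_image_sub_le_of_norm_hasDerivWithin_le
    (f := fun s => f (t, s)) (f' := fun s => dy f (t, s)) (fun s hs => ?_)
    (fun s hs => (hmem s hs).2) (Metric.mem_closedBall_self ((abs_nonneg _).trans hy))
    (by simpa [Real.dist_eq] using hy)
  exact (hasDerivAt_dy (P := (t, s)) (differentiableAt_of_contDiffOn hT hf one_ne_zero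
    (hmem s hs).1)).hasDerivWithinAt

/-- Continuous dependence on the initial point: a characteristic `h` which starts close to the
characteristic `g`, over any right part `[a', b]` of its interval, stays close to it. -/
lemma IsChar.exists_stable (hT : IsOpen T) (hu : ContDiffOn ℝ 1 u T) (hg : IsChar T u a b g)
    {ε : ℝ} (hε : 0 < ε) :
    ∃ δ > 0, ∀ a' ∈ Icc a b, ∀ h, IsChar T u a' b h → |h a' - g a'| ≤ δ →
      ∀ t ∈ Icc a' b, |h t - g t| ≤ ε := by
  obtain ⟨ρ, hρ, M, hM, htube⟩ := exists_tube hT (continuousOn_dy hT hu) hg.continuousOn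
    fun t ht => (hg t ht).1
  refine ⟨min ρ ε * Real.exp (-((M + 1) * (b - a))), by positivity, fun a' ha' h hh h0 => ?_⟩
  -- the barrier `B` below, which starts at `δ`, reaches at most `min ρ ε`, so `h` is kept in the
  -- tube where the Lipschitz bound `M` holds
  set δ := min ρ ε * Real.exp (-((M + 1) * (b - a))) with hδ
  have hδ0 : 0 < δ := by positivity
  -- the barrier grows faster than the Lipschitz estimate allows the distance to grow
  set B : ℝ → ℝ := fun t => δ * Real.exp ((M + 1) * (t - a')) with hB
  have hBle : ∀ t ∈ Icc a' b, B t ≤ min ρ ε := by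
    intro t ht
    have h1 : B t = min ρ ε * Real.exp (-((M + 1) * (b - a)) + (M + 1) * (t - a')) := by
      rw [hB, hδ, Real.exp_add]; ring
    rw [h1]
    refine mul_le_of_le_one_right (by positivity) (Real.exp_le_one_iff.2 ?_)
    nlinarith [ht.2, ha'.1]
  have hBd : ∀ t, HasDerivAt B ((M + 1) * B t) t := by
    intro t
    have h1 := ((((hasDerivAt_id t).sub_const a').const_mul (M + 1)).exp).const_mul δ
    refine h1.congr_deriv ?_
    simp only [hB, id]; ring
  have hg' := hg.mono ha'.1 le_rfl
  have key := image_norm_le_of_norm_deriv_right_lt_deriv_boundary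
    (f := fun t => h t - g t) (f' := fun t => u (t, h t) - u (t, g t)) (a := a') (b := b)
    (B := B) (B' := fun t => (M + 1) * B t)
    (hh.continuousOn.sub hg'.continuousOn)
    (fun t ht => hasDerivWithinAt_Ici_of_Icc
      ((hh t (Ico_subset_Icc_self ht)).2.sub (hg' t (Ico_subset_Icc_self ht)).2) ht)
    (by simpa [hB] using h0) hBd ?_
  · intro t ht
    exact (key ht).trans ((hBle t ht).trans (min_le_right _ _))
  · intro t ht heq
    have ht' := Ico_subset_Icc_self ht
    have hle : |h t - g t| ≤ ρ := by
      rw [← Real.norm_eq_abs, heq]; exact (hBle t ht').trans (min_le_left _ _)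
    have := abs_sub_le_of_dy_le hT hu
      (htube t ⟨ha'.1.trans ht'.1, ht'.2⟩) hle
    rw [← Real.norm_eq_abs (h t - g t), heq] at this
    have hBpos : 0 < B t := by positivity
    rw [Real.norm_eq_abs]
    linarith

lemma IsChar.eqOn (hT : IsOpen T) (hu : ContDiffOn ℝ 1 u T) (hg : IsChar T u a b g)
    (hh : IsChar T u a b h) (h0 : h a = g a) {t : ℝ} (ht : t ∈ Icc a b) : h t = g t := by
  refine eq_of_abs_sub_le_all fun ε hε => ?_
  obtain ⟨δ, hδ, H⟩ := hg.exists_stable hT hu hε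
  exact H a ⟨le_rfl, ht.1.trans ht.2⟩ h hh (by simp [h0, hδ.le]) t ht

/-- Characteristics cannot travel far in a short time: if `h` starts near `(a, y₀)`, slightly
before `a`, then it passes near `(a, y₀)`. -/
lemma exists_pass_near (hT : IsOpen T) (hu : ContinuousOn u T) {y₀ : ℝ} (hP : (a, y₀) ∈ T)
    {ε : ℝ} (hε : 0 < ε) :
    ∃ δ > 0, ∀ a' ∈ Icc (a - δ) a, ∀ h, IsChar T u a' a h → |h a' - y₀| ≤ δ → |h a - y₀| ≤ ε := by
  obtain ⟨r, hr, hball⟩ : ∃ r > 0, ∀ Q, dist Q (a, y₀) ≤ r → ‖u Q - u (a, y₀)‖ < 1 := by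
    have := Metric.tendsto_nhds.1 (hu.continuousAt (hT.mem_nhds hP)) 1 one_pos
    obtain ⟨r, hr, H⟩ := Metric.eventually_nhds_iff.1 this
    exact ⟨r / 2, half_pos hr, fun Q hQ => by
      rw [← dist_eq_norm]; exact H (hQ.trans_lt (half_lt_self hr))⟩
  set M := |u (a, y₀)| + 2 with hM
  have hM0 : 0 < M := by positivity
  refine ⟨min r ε / (1 + M), by positivity, fun a' ha' h hh h0 => ?_⟩
  -- the speed is below `M` near `(a, y₀)`, and `δ + M δ` is the distance allowed
  set δ := min r ε / (1 + M) with hδ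
  have hδM : δ * (1 + M) = min r ε := div_mul_cancel₀ _ (by positivity)
  have hδ0 : 0 < δ := by positivity
  set B : ℝ → ℝ := fun t => δ + M * (t - a') with hB
  have hBle : ∀ t ∈ Icc a' a, B t ≤ min r ε := by
    intro t ht
    have : t - a' ≤ δ := by linarith [ht.2, ha'.1]
    have := mul_le_mul_of_nonneg_left this hM0.le
    simp only [hB]; linarith
  have key := image_norm_le_of_norm_deriv_right_lt_deriv_boundary
    (f := fun t => h t - y₀) (f' := fun t => u (t, h t)) (a := a') (b := a)
    (B := B) (B' := fun _ => M)
    (hh.continuousOn.sub continuousOn_const)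
    (fun t ht => hasDerivWithinAt_Ici_of_Icc
      ((hh t (Ico_subset_Icc_self ht)).2.sub_const _) ht)
    (by simpa [hB] using h0)
    (fun t => by
      simpa [hB] using (((hasDerivAt_id t).sub_const a').const_mul M).const_add δ) ?_
  · exact (key ⟨ha'.2, le_rfl⟩).trans ((hBle a ⟨ha'.2, le_rfl⟩).trans (min_le_right _ _))
  · intro t ht heq
    have ht' := Ico_subset_Icc_self ht
    have h1 : ‖u (t, h t) - u (a, y₀)‖ < 1 := by
      refine hball _ ?_
      rw [Prod.dist_eq, max_le_iff]
      constructor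
      · have hδr : δ ≤ r := by nlinarith [min_le_left r ε]
        simp only [Real.dist_eq]
        rw [abs_le]; constructor <;> linarith [ht'.1, ht'.2, ha'.1]
      · simp only [Real.dist_eq]
        rw [← Real.norm_eq_abs, heq]; exact (hBle t ht').trans (min_le_left _ _)
    have h2 := norm_le_norm_add_norm_sub' (u (t, h t)) (u (a, y₀))
    simp only [Real.norm_eq_abs] at *
    linarith

end Char

/-! ### Characteristic triangles -/

section Triangle

variable {T : Set (ℝ × ℝ)} {u u₁ u₂ : ℝ × ℝ → ℝ} {a b : ℝ} {g h : ℝ → ℝ}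

/-- Characteristics of one family do not cross. -/
lemma IsChar.le_of_le (hT : IsOpen T) (hu : ContDiffOn ℝ 1 u T) (hg : IsChar T u a b g)
    (hh : IsChar T u a b h) (h0 : g a ≤ h a) {t : ℝ} (ht : t ∈ Icc a b) : g t ≤ h t := by
  by_contra! hlt
  have hsub : Icc a t ⊆ Icc a b := Icc_subset_Icc_right ht.2
  obtain ⟨s, hs, hs0⟩ : (0 : ℝ) ∈ (fun s => g s - h s) '' Icc a t :=
    intermediate_value_Icc ht.1 ((hg.continuousOn.mono hsub).sub (hh.continuousOn.mono hsub))
      ⟨sub_nonpos.2 h0, sub_nonneg.2 hlt.le⟩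
  have := (hh.mono hs.1 le_rfl).eqOn hT hu (hg.mono hs.1 le_rfl)
    (sub_eq_zero.1 hs0) ⟨hs.2, ht.2⟩
  linarith

/-- A characteristic of the faster family crosses one of the slower family only upwards. -/
lemma IsChar.le_of_lt (hlt : ∀ P ∈ T, u₁ P < u₂ P) (hg : IsChar T u₁ a b g)
    (hh : IsChar T u₂ a b h) (h0 : g a ≤ h a) {t : ℝ} (ht : t ∈ Icc a b) : g t ≤ h t := by
  refine image_le_of_deriv_right_lt_deriv_boundary' hg.continuousOn
    (fun s hs => hasDerivWithinAt_Ici_of_Icc (hg s (Ico_subset_Icc_self hs)).2 hs) h0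
    hh.continuousOn
    (fun s hs => hasDerivWithinAt_Ici_of_Icc (hh s (Ico_subset_Icc_self hs)).2 hs)
    (fun s hs heq => ?_) ht
  rw [← heq]
  exact hlt _ (hg s (Ico_subset_Icc_self hs)).1

/-- Every point of `T` with `x ≤ 0` is joined to the axis inside `T` by a characteristic of slope
`u`. On this side of the axis characteristics approach it with increasing `x`. -/
def ReachesAxis (T : Set (ℝ × ℝ)) (u : ℝ × ℝ → ℝ) : Prop :=
  ∀ P ∈ T, P.1 ≤ 0 → ∃ g, IsChar T u P.1 0 g ∧ g P.1 = P.2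

/-- If the characteristics `γ τ` of slope `u` start from the points `(τ, h τ)` of a continuous
curve, the height at which they cross the line `x = b` depends continuously on `τ`. -/
lemma continuousOn_sweep (hT : IsOpen T) (hu : ContDiffOn ℝ 1 u T)
    (hh : ContinuousOn h (Icc a b)) {γ : ℝ → ℝ → ℝ}
    (hγ : ∀ τ ∈ Icc a b, IsChar T u τ b (γ τ) ∧ γ τ τ = h τ) :
    ContinuousOn (fun τ => γ τ b) (Icc a b) := by
  intro τ₀ hτ₀
  obtain ⟨hγ₀, hγ₀h⟩ := hγ τ₀ hτ₀
  rw [ContinuousWithinAt, Metric.tendsto_nhds]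
  intro ε hε
  obtain ⟨δ₁, hδ₁, H₁⟩ := hγ₀.exists_stable hT hu (half_pos hε)
  obtain ⟨δ₂, hδ₂, H₂⟩ := exists_pass_near hT hu.continuousOn
    (by rw [← hγ₀h]; exact (hγ₀ τ₀ ⟨le_rfl, hτ₀.2⟩).1 : (τ₀, h τ₀) ∈ T) hδ₁
  have hδ₃ : 0 < min δ₂ (δ₁ / 2) := by positivity
  have c₁ := Metric.tendsto_nhds.1 (hh τ₀ hτ₀) _ hδ₃
  have c₂ : ∀ᶠ τ in 𝓝[Icc a b] τ₀, τ ∈ Icc τ₀ b → dist (γ τ₀ τ) (γ τ₀ τ₀) < δ₁ / 2 := by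
    have h1 := Metric.tendsto_nhds.1 (hγ₀.continuousOn τ₀ ⟨le_rfl, hτ₀.2⟩) _ (half_pos hδ₁)
    rw [eventually_nhdsWithin_iff] at h1 ⊢
    filter_upwards [h1] with τ h2 _ using h2
  have c₃ : ∀ᶠ τ in 𝓝[Icc a b] τ₀, τ₀ - δ₂ < τ :=
    nhdsWithin_le_nhds (lt_mem_nhds (by linarith))
  filter_upwards [c₁, c₂, c₃, self_mem_nhdsWithin] with τ k₁ k₂ k₃ hτ
  obtain ⟨hγτ, hγτh⟩ := hγ τ hτ
  simp only [Real.dist_eq] at *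
  refine lt_of_le_of_lt ?_ (half_lt_self hε)
  rcases le_total τ₀ τ with hle | hle
  · -- `τ` lies to the right of `τ₀`: compare both curves on `[τ, b]`
    refine H₁ τ ⟨hle, hτ.2⟩ _ hγτ ?_ b ⟨hτ.2, le_rfl⟩
    have := k₂ ⟨hle, hτ.2⟩
    rw [hγτh]
    rw [hγ₀h] at this
    have e : h τ - γ τ₀ τ = (h τ - h τ₀) - (γ τ₀ τ - h τ₀) := by ring
    rw [e]
    refine (abs_sub _ _).trans ?_
    linarith [min_le_right δ₂ (δ₁ / 2)]
  · -- `τ` lies to the left of `τ₀`: the curve first has to reach the line through `τ₀`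
    refine H₁ τ₀ ⟨le_rfl, hτ₀.2⟩ _ (hγτ.mono hle le_rfl) ?_ b ⟨hτ₀.2, le_rfl⟩
    rw [hγ₀h]
    refine H₂ τ ⟨k₃.le, hle⟩ _ (hγτ.mono le_rfl hτ₀.2) ?_
    rw [hγτh]
    exact k₁.le.trans (min_le_left _ _)

/-- The triangle cut out by the two characteristics through a point of `T` and the axis lies in
`T`, and no characteristic leaves it on its way to the axis. It lies in `T`, although `T` need not
be simply connected, because it is swept by the characteristics of the first family that start
from the upper side. -/
lemma exists_triangle (hT : IsOpen T) (hu₁ : ContDiffOn ℝ 1 u₁ T) (hu₂ : ContDiffOn ℝ 1 u₂ T)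
    (hlt : ∀ P ∈ T, u₁ P < u₂ P) (hr₁ : ReachesAxis T u₁) (hr₂ : ReachesAxis T u₂)
    {P : ℝ × ℝ} (hP : P ∈ T) (hP0 : P.1 ≤ 0) :
    ∃ K, IsCompact K ∧ K ⊆ T ∧ P ∈ K ∧ (∀ Q ∈ K, Q.1 ≤ 0) ∧
      (∀ Q ∈ K, ∀ g, IsChar T u₁ Q.1 0 g → g Q.1 = Q.2 → ∀ t ∈ Icc Q.1 0, (t, g t) ∈ K) ∧
      (∀ Q ∈ K, ∀ g, IsChar T u₂ Q.1 0 g → g Q.1 = Q.2 → ∀ t ∈ Icc Q.1 0, (t, g t) ∈ K) := by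
  obtain ⟨g₁, hg₁, hg₁P⟩ := hr₁ P hP hP0
  obtain ⟨g₂, hg₂, hg₂P⟩ := hr₂ P hP hP0
  have hle : ∀ t ∈ Icc P.1 0, g₁ t ≤ g₂ t := fun t ht =>
    hg₁.le_of_lt hlt hg₂ (by rw [hg₁P, hg₂P]) ht
  set K : Set (ℝ × ℝ) :=
    (fun q : ℝ × ℝ => (q.1, (1 - q.2) • g₁ q.1 + q.2 • g₂ q.1)) '' (Icc P.1 0 ×ˢ Icc 0 1) with hK
  have hmem : ∀ Q : ℝ × ℝ, Q ∈ K ↔ Q.1 ∈ Icc P.1 0 ∧ Q.2 ∈ Icc (g₁ Q.1) (g₂ Q.1) := by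
    rintro ⟨t, y⟩
    have key : t ∈ Icc P.1 0 →
        Icc (g₁ t) (g₂ t) = (fun θ : ℝ => (1 - θ) • g₁ t + θ • g₂ t) '' Icc 0 1 := fun ht => by
      rw [← segment_eq_image, segment_eq_Icc (hle t ht)]
    constructor
    · rintro ⟨⟨s, θ⟩, ⟨hs, hθ⟩, heq⟩
      obtain ⟨rfl, rfl⟩ := Prod.mk.inj heq
      refine ⟨hs, ?_⟩
      simp only
      rw [key hs]
      exact ⟨θ, hθ, rfl⟩
    · rintro ⟨ht, hy⟩
      simp only at ht hy
      rw [key ht] at hy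
      obtain ⟨θ, hθ, rfl⟩ := hy
      exact ⟨(t, θ), ⟨ht, hθ⟩, rfl⟩
  have hcomp : IsCompact K := by
    refine (isCompact_Icc.prod isCompact_Icc).image_of_continuousOn ?_
    have c₁ : ContinuousOn (fun q : ℝ × ℝ => g₁ q.1) (Icc P.1 0 ×ˢ Icc 0 1) :=
      hg₁.continuousOn.comp continuousOn_fst fun q hq => hq.1
    have c₂ : ContinuousOn (fun q : ℝ × ℝ => g₂ q.1) (Icc P.1 0 ×ˢ Icc 0 1) :=
      hg₂.continuousOn.comp continuousOn_fst fun q hq => hq.1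
    exact continuousOn_fst.prodMk
      (((continuousOn_const.sub continuousOn_snd).smul c₁).add (continuousOn_snd.smul c₂))
  have hKT : K ⊆ T := by
    intro Q hQ
    obtain ⟨⟨hQ1, hQ1'⟩, hQ2, hQ2'⟩ := (hmem Q).1 hQ
    have hex : ∀ τ, ∃ γ : ℝ → ℝ, τ ∈ Icc P.1 Q.1 → IsChar T u₁ τ Q.1 γ ∧ γ τ = g₂ τ := by
      intro τ
      by_cases hτ : τ ∈ Icc P.1 Q.1
      · obtain ⟨γ, hγ, hγτ⟩ := hr₁ (τ, g₂ τ) (hg₂ τ ⟨hτ.1, hτ.2.trans hQ1'⟩).1 (hτ.2.trans hQ1')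
        exact ⟨γ, fun _ => ⟨hγ.mono le_rfl hQ1', hγτ⟩⟩
      · exact ⟨0, fun h => absurd h hτ⟩
    choose γ hγ using hex
    have hcont := continuousOn_sweep hT hu₁
      (hg₂.continuousOn.mono (Icc_subset_Icc_right hQ1')) hγ
    have hend := (hγ Q.1 ⟨hQ1, le_rfl⟩).2
    have hstart : γ P.1 Q.1 = g₁ Q.1 := by
      obtain ⟨k1, k2⟩ := hγ P.1 ⟨le_rfl, hQ1⟩
      exact (hg₁.mono le_rfl hQ1').eqOn hT hu₁ k1 (by rw [k2, hg₁P, hg₂P]) ⟨hQ1, le_rfl⟩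
    obtain ⟨τ, hτ, hτQ⟩ : Q.2 ∈ (fun τ => γ τ Q.1) '' Icc P.1 Q.1 :=
      intermediate_value_Icc hQ1 hcont (by rw [hend, hstart]; exact ⟨hQ2, hQ2'⟩)
    have := ((hγ τ hτ).1 Q.1 ⟨hτ.2, le_rfl⟩).1
    simp only at hτQ
    rwa [hτQ] at this
  refine ⟨K, hcomp, hKT, (hmem P).2 ⟨⟨le_rfl, hP0⟩, by rw [hg₁P], by rw [hg₂P]⟩,
    fun Q hQ => ((hmem Q).1 hQ).1.2, fun Q hQ g hg hgQ t ht => ?_, fun Q hQ g hg hgQ t ht => ?_⟩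
  · obtain ⟨⟨hQ1, hQ1'⟩, hQ2, hQ2'⟩ := (hmem Q).1 hQ
    exact (hmem _).2 ⟨⟨hQ1.trans ht.1, ht.2⟩,
      (hg₁.mono hQ1 le_rfl).le_of_le hT hu₁ hg (by rwa [hgQ]) ht,
      hg.le_of_lt hlt (hg₂.mono hQ1 le_rfl) (by rwa [hgQ]) ht⟩
  · obtain ⟨⟨hQ1, hQ1'⟩, hQ2, hQ2'⟩ := (hmem Q).1 hQ
    exact (hmem _).2 ⟨⟨hQ1.trans ht.1, ht.2⟩,
      (hg₁.mono hQ1 le_rfl).le_of_lt hlt hg (by rwa [hgQ]) ht,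
      hg.le_of_le hT hu₂ (hg₂.mono hQ1 le_rfl) (by rwa [hgQ]) ht⟩

end Triangle

/-! ### Uniqueness for functions transported along two families of characteristics -/

section Transport

variable {E E₁ E₂ : Type*} [NormedAddCommGroup E] [NormedSpace ℝ E] [NormedAddCommGroup E₁]
  [NormedSpace ℝ E₁] [NormedAddCommGroup E₂] [NormedSpace ℝ E₂] {T : Set (ℝ × ℝ)}

/-- `Φ` is differentiable along the characteristics of slope `u` inside `T`, and the norm of its
derivative along them is at most `r`. The function `Φ` itself need not be differentiable. -/
def IsTransported (T : Set (ℝ × ℝ)) (u : ℝ × ℝ → ℝ) (Φ : ℝ × ℝ → E) (r : ℝ × ℝ → ℝ) : Prop :=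
  ∀ a b g, IsChar T u a b g → ∀ t ∈ Icc a b,
    ∃ d, HasDerivWithinAt (fun s => Φ (s, g s)) d (Icc a b) t ∧ ‖d‖ ≤ r (t, g t)

/-- If the derivative along a characteristic decays like `exp (-L x)` towards the axis and the
function vanishes there, integration gains the factor `1 / L`. -/
lemma norm_le_of_isTransported {u : ℝ × ℝ → ℝ} {Φ : ℝ × ℝ → E} {r : ℝ × ℝ → ℝ}
    (hΦ : IsTransported T u Φ r) {a C L : ℝ} (ha : a ≤ 0) (hL : 0 < L) (hC : 0 ≤ C) {g : ℝ → ℝ}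
    (hg : IsChar T u a 0 g) (hr : ∀ t ∈ Icc a 0, r (t, g t) ≤ C * Real.exp (-(L * t)))
    (h0 : Φ (0, g 0) = 0) : ‖Φ (a, g a)‖ ≤ C / L * Real.exp (-(L * a)) := by
  choose! d hd hdr using hΦ a 0 g hg
  have hB : ∀ t, HasDerivAt
      (fun t => C / L * (Real.exp (-(L * a)) - Real.exp (-(L * t))))
      (C * Real.exp (-(L * t))) t := by
    intro t
    have := ((((hasDerivAt_id t).const_mul L).neg.exp).const_sub
      (Real.exp (-(L * a)))).const_mul (C / L)
    refine this.congr_deriv ?_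
    simp only [id, Pi.neg_apply]; field_simp
  have key := image_norm_le_of_norm_deriv_right_le_deriv_boundary
    (f := fun t => Φ (t, g t) - Φ (a, g a)) (f' := d) (a := a) (b := 0)
    (fun t ht => ((hd t ht).sub_const _).continuousWithinAt)
    (fun t ht => hasDerivWithinAt_Ici_of_Icc ((hd t (Ico_subset_Icc_self ht)).sub_const _) ht)
    (by simp) hB
    (fun t ht => (hdr t (Ico_subset_Icc_self ht)).trans (hr t (Ico_subset_Icc_self ht)))
  have := key (show (0 : ℝ) ∈ Icc a 0 from ⟨ha, le_rfl⟩)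
  rw [h0, zero_sub, norm_neg] at this
  refine this.trans (mul_le_mul_of_nonneg_left ?_ (by positivity))
  linarith [Real.exp_pos (-(L * 0))]

/-- On the characteristic triangle of a point the weighted maximum of `Φ₁` and `Φ₂` is at most
half of itself, because each of them is the integral of its derivative from the axis. -/
lemma eq_zero_of_isTransported_left {u₁ u₂ : ℝ × ℝ → ℝ} {Φ₁ : ℝ × ℝ → E₁} {Φ₂ : ℝ × ℝ → E₂}
    {A : ℝ × ℝ → ℝ} (hT : IsOpen T) (hu₁ : ContDiffOn ℝ 1 u₁ T) (hu₂ : ContDiffOn ℝ 1 u₂ T)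
    (hlt : ∀ P ∈ T, u₁ P < u₂ P) (hr₁ : ReachesAxis T u₁) (hr₂ : ReachesAxis T u₂)
    (hA : ContinuousOn A T) (hc₁ : ContinuousOn Φ₁ T) (hc₂ : ContinuousOn Φ₂ T)
    (h₁ : IsTransported T u₁ Φ₁ fun P => A P * (‖Φ₁ P‖ + ‖Φ₂ P‖))
    (h₂ : IsTransported T u₂ Φ₂ fun P => A P * (‖Φ₁ P‖ + ‖Φ₂ P‖))
    (h0₁ : ∀ y, (0, y) ∈ T → Φ₁ (0, y) = 0) (h0₂ : ∀ y, (0, y) ∈ T → Φ₂ (0, y) = 0)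
    {P : ℝ × ℝ} (hP : P ∈ T) (hP0 : P.1 ≤ 0) : Φ₁ P = 0 ∧ Φ₂ P = 0 := by
  obtain ⟨K, hK, hKT, hPK, hK0, hinv₁, hinv₂⟩ :=
    exists_triangle hT hu₁ hu₂ hlt hr₁ hr₂ hP hP0
  obtain ⟨A₀, hA₀⟩ := hK.exists_bound_of_continuousOn (hA.mono hKT)
  have hA₀0 : 0 ≤ A₀ := (norm_nonneg _).trans (hA₀ P hPK)
  -- with this weight the gain `1 / L` of the integration beats the rate `2 * A₀`
  set L := 4 * A₀ + 1 with hL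
  have hL0 : 0 < L := by positivity
  set N : ℝ × ℝ → ℝ := fun Q => max ‖Φ₁ Q‖ ‖Φ₂ Q‖ with hN
  obtain ⟨Q, hQ, hmax⟩ := hK.exists_isMaxOn ⟨P, hPK⟩
    (f := fun Q => N Q * Real.exp (L * Q.1))
    (ContinuousOn.mul ((hc₁.mono hKT).norm.sup (hc₂.mono hKT).norm) (by fun_prop))
  set μ := N Q * Real.exp (L * Q.1) with hμ
  have hN0 : ∀ R, 0 ≤ N R := fun R => (norm_nonneg _).trans (le_max_left _ _)
  have hμ0 : 0 ≤ μ := mul_nonneg (hN0 Q) (Real.exp_pos _).le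
  have hNle : ∀ R ∈ K, N R ≤ μ * Real.exp (-(L * R.1)) := by
    intro R hR
    have := hmax hR
    rw [Real.exp_neg, ← div_eq_mul_inv, le_div_iff₀ (Real.exp_pos _)]
    exact this
  have hrate : ∀ R ∈ K,
      A R * (‖Φ₁ R‖ + ‖Φ₂ R‖) ≤ 2 * A₀ * μ * Real.exp (-(L * R.1)) := by
    intro R hR
    have h1 : ‖Φ₁ R‖ + ‖Φ₂ R‖ ≤ 2 * (μ * Real.exp (-(L * R.1))) := by
      linarith [hNle R hR, le_max_left ‖Φ₁ R‖ ‖Φ₂ R‖, le_max_right ‖Φ₁ R‖ ‖Φ₂ R‖]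
    calc A R * (‖Φ₁ R‖ + ‖Φ₂ R‖) ≤ A₀ * (‖Φ₁ R‖ + ‖Φ₂ R‖) :=
          mul_le_mul_of_nonneg_right ((le_abs_self _).trans (hA₀ R hR)) (by positivity)
      _ ≤ A₀ * (2 * (μ * Real.exp (-(L * R.1)))) := mul_le_mul_of_nonneg_left h1 hA₀0
      _ = _ := by ring
  have hhalf : N Q ≤ 2 * A₀ * μ / L * Real.exp (-(L * Q.1)) := by
    refine max_le ?_ ?_
    · obtain ⟨g, hg, hgQ⟩ := hr₁ Q (hKT hQ) (hK0 Q hQ)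
      have := norm_le_of_isTransported h₁ (hK0 Q hQ) hL0 (by positivity) hg
        (fun t ht => hrate _ (hinv₁ Q hQ g hg hgQ t ht))
        (h0₁ _ (hg 0 ⟨hK0 Q hQ, le_rfl⟩).1)
      rwa [hgQ] at this
    · obtain ⟨g, hg, hgQ⟩ := hr₂ Q (hKT hQ) (hK0 Q hQ)
      have := norm_le_of_isTransported h₂ (hK0 Q hQ) hL0 (by positivity) hg
        (fun t ht => hrate _ (hinv₂ Q hQ g hg hgQ t ht))
        (h0₂ _ (hg 0 ⟨hK0 Q hQ, le_rfl⟩).1)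
      rwa [hgQ] at this
  have hμle : μ ≤ 2 * A₀ * μ / L := by
    have := mul_le_mul_of_nonneg_right hhalf (Real.exp_pos (L * Q.1)).le
    rwa [mul_assoc, ← Real.exp_add, neg_add_cancel, Real.exp_zero, mul_one] at this
  have hμ_eq : μ = 0 := by
    rw [le_div_iff₀ hL0] at hμle
    nlinarith
  have hNP := hNle P hPK
  rw [hμ_eq, zero_mul] at hNP
  exact ⟨norm_le_zero_iff.1 ((le_max_left _ _).trans hNP),
    norm_le_zero_iff.1 ((le_max_right _ _).trans hNP)⟩

/-- The reflection in the axis `x = 0`. -/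
def reflect (P : ℝ × ℝ) : ℝ × ℝ := (-P.1, P.2)

lemma contDiff_reflect {n : WithTop ℕ∞} : ContDiff ℝ n reflect := by
  unfold reflect; fun_prop

lemma hasDerivWithinAt_comp_neg {f : ℝ → E} {d : E} {a b t : ℝ}
    (hf : HasDerivWithinAt f d (Icc (-b) (-a)) (-t)) :
    HasDerivWithinAt (fun s => f (-s)) (-d) (Icc a b) t := by
  have := hf.scomp t (h := fun s => -s) (h' := -1) (s := Icc a b)
    (hasDerivAt_neg t).hasDerivWithinAt
    (fun s hs => ⟨neg_le_neg hs.2, neg_le_neg hs.1⟩)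
  rw [neg_one_smul] at this
  exact this

lemma IsChar.comp_reflect {u : ℝ × ℝ → ℝ} {a b : ℝ} {g : ℝ → ℝ} (hg : IsChar T u (-b) (-a) g) :
    IsChar (reflect ⁻¹' T) (fun P => -u (reflect P)) a b fun s => g (-s) := fun t ht =>
  have h := hg (-t) ⟨neg_le_neg ht.2, neg_le_neg ht.1⟩
  ⟨h.1, hasDerivWithinAt_comp_neg h.2⟩

lemma IsChar.of_reflect {u : ℝ × ℝ → ℝ} {a b : ℝ} {g : ℝ → ℝ}
    (hg : IsChar (reflect ⁻¹' T) (fun P => -u (reflect P)) a b g) :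
    IsChar T u (-b) (-a) fun s => g (-s) := by
  intro t ht
  have h := hg (-t) ⟨by linarith [ht.2], by linarith [ht.1]⟩
  have h' : HasDerivWithinAt g (-u (t, g (-t))) (Icc (- -a) (- -b)) (-t) := by
    simpa [reflect] using h.2
  refine ⟨by simpa [reflect] using h.1, ?_⟩
  simpa using hasDerivWithinAt_comp_neg h'

lemma IsTransported.comp_reflect {u : ℝ × ℝ → ℝ} {Φ : ℝ × ℝ → E} {r : ℝ × ℝ → ℝ}
    (h : IsTransported T u Φ r) :
    IsTransported (reflect ⁻¹' T) (fun P => -u (reflect P))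
      (fun P => Φ (reflect P)) fun P => r (reflect P) := by
  intro a b g hg t ht
  obtain ⟨d, hd, hdr⟩ := h _ _ _ hg.of_reflect (-t) ⟨neg_le_neg ht.2, neg_le_neg ht.1⟩
  rw [neg_neg] at hdr
  refine ⟨-d, ?_, by rwa [norm_neg]⟩
  have := hasDerivWithinAt_comp_neg hd
  simp only [neg_neg] at this
  exact this

lemma reachesAxis_of_characteristicsReachAxis {u : ℝ × ℝ → ℝ}
    (h : CharacteristicsReachAxis T u) : ReachesAxis T u := by
  rintro ⟨x, y⟩ hP hx
  obtain ⟨g, hgx, hg⟩ := h x y hP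
  rw [uIcc_of_ge hx] at hg
  exact ⟨g, hg, hgx⟩

lemma reachesAxis_reflect {u : ℝ × ℝ → ℝ} (h : CharacteristicsReachAxis T u) :
    ReachesAxis (reflect ⁻¹' T) fun P => -u (reflect P) := by
  rintro ⟨x, y⟩ hP hx
  obtain ⟨g, hgx, hg⟩ := h (-x) y hP
  rw [uIcc_of_le (neg_nonneg.2 hx)] at hg
  have hg' : IsChar T u (-0) (-x) g := by rw [neg_zero]; exact hg
  exact ⟨_, hg'.comp_reflect, hgx⟩

lemma eq_zero_of_isTransported_of_lt {u₁ u₂ : ℝ × ℝ → ℝ} {Φ₁ : ℝ × ℝ → E₁} {Φ₂ : ℝ × ℝ → E₂}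
    {A : ℝ × ℝ → ℝ} (hT : IsOpen T) (hu₁ : ContDiffOn ℝ 1 u₁ T) (hu₂ : ContDiffOn ℝ 1 u₂ T)
    (hlt : ∀ P ∈ T, u₁ P < u₂ P) (hdet : IsDomainOfDeterminacy T u₁ u₂)
    (hA : ContinuousOn A T) (hc₁ : ContinuousOn Φ₁ T) (hc₂ : ContinuousOn Φ₂ T)
    (h₁ : IsTransported T u₁ Φ₁ fun P => A P * (‖Φ₁ P‖ + ‖Φ₂ P‖))
    (h₂ : IsTransported T u₂ Φ₂ fun P => A P * (‖Φ₁ P‖ + ‖Φ₂ P‖))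
    (h0₁ : ∀ y, (0, y) ∈ T → Φ₁ (0, y) = 0) (h0₂ : ∀ y, (0, y) ∈ T → Φ₂ (0, y) = 0)
    {P : ℝ × ℝ} (hP : P ∈ T) : Φ₁ P = 0 ∧ Φ₂ P = 0 := by
  rcases le_total P.1 0 with hP0 | hP0
  · exact eq_zero_of_isTransported_left hT hu₁ hu₂ hlt
      (reachesAxis_of_characteristicsReachAxis hdet.1)
      (reachesAxis_of_characteristicsReachAxis hdet.2) hA hc₁ hc₂ h₁ h₂ h0₁ h0₂ hP hP0
  · have hmaps : MapsTo reflect (reflect ⁻¹' T) T := fun _ h => h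
    have hcont : ContinuousOn reflect (reflect ⁻¹' T) :=
      (contDiff_reflect (n := 0)).continuous.continuousOn
    -- the reflection reverses the sign of the slopes, hence exchanges the two families
    have key := eq_zero_of_isTransported_left (T := reflect ⁻¹' T)
      (u₁ := fun P => -u₂ (reflect P)) (u₂ := fun P => -u₁ (reflect P))
      (Φ₁ := fun P => Φ₂ (reflect P)) (Φ₂ := fun P => Φ₁ (reflect P))
      (A := fun P => A (reflect P)) (P := reflect P)
      (hT.preimage (contDiff_reflect (n := 0)).continuous)
      (hu₂.comp contDiff_reflect.contDiffOn hmaps).neg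
      (hu₁.comp contDiff_reflect.contDiffOn hmaps).neg
      (fun Q hQ => neg_lt_neg (hlt _ hQ)) (reachesAxis_reflect hdet.2)
      (reachesAxis_reflect hdet.1) (hA.comp hcont hmaps) (hc₂.comp hcont hmaps)
      (hc₁.comp hcont hmaps)
      (by simpa only [add_comm] using h₂.comp_reflect)
      (by simpa only [add_comm] using h₁.comp_reflect)
      (fun y hy => by simpa [reflect] using h0₂ y (by simpa [reflect] using hy))
      (fun y hy => by simpa [reflect] using h0₁ y (by simpa [reflect] using hy))
      (by simpa [reflect] using hP) (by simpa [reflect] using hP0)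
    simp only [reflect, neg_neg] at key
    exact ⟨key.2, key.1⟩

/-- Two functions on a domain of determinacy which vanish on the axis, and whose derivatives along
the first and the second family of characteristics respectively are linearly bounded by the two
functions, vanish. -/
theorem eq_zero_of_isTransported {u₁ u₂ : ℝ × ℝ → ℝ} {Φ₁ : ℝ × ℝ → E₁} {Φ₂ : ℝ × ℝ → E₂}
    {A : ℝ × ℝ → ℝ} (hT : IsOpen T) (hTc : IsPreconnected T) (hu₁ : ContDiffOn ℝ 1 u₁ T)
    (hu₂ : ContDiffOn ℝ 1 u₂ T) (hne : ∀ P ∈ T, u₁ P ≠ u₂ P)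
    (hdet : IsDomainOfDeterminacy T u₁ u₂)
    (hA : ContinuousOn A T) (hc₁ : ContinuousOn Φ₁ T) (hc₂ : ContinuousOn Φ₂ T)
    (h₁ : IsTransported T u₁ Φ₁ fun P => A P * (‖Φ₁ P‖ + ‖Φ₂ P‖))
    (h₂ : IsTransported T u₂ Φ₂ fun P => A P * (‖Φ₁ P‖ + ‖Φ₂ P‖))
    (h0₁ : ∀ y, (0, y) ∈ T → Φ₁ (0, y) = 0) (h0₂ : ∀ y, (0, y) ∈ T → Φ₂ (0, y) = 0)
    {P : ℝ × ℝ} (hP : P ∈ T) : Φ₁ P = 0 ∧ Φ₂ P = 0 := by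
  have hlt_or : (∀ Q ∈ T, u₁ Q < u₂ Q) ∨ ∀ Q ∈ T, u₂ Q < u₁ Q := by
    by_contra! hcon
    obtain ⟨⟨Q, hQ, hQle⟩, R, hR, hRle⟩ := hcon
    obtain ⟨S, hS, hS'⟩ :=
      hTc.intermediate_value₂ hR hQ hu₁.continuousOn hu₂.continuousOn hRle hQle
    exact hne S hS hS'
  rcases hlt_or with hlt | hlt
  · exact eq_zero_of_isTransported_of_lt hT hu₁ hu₂ hlt hdet hA hc₁ hc₂ h₁ h₂ h0₁ h0₂ hP
  · exact (eq_zero_of_isTransported_of_lt hT hu₂ hu₁ hlt ⟨hdet.2, hdet.1⟩ hA hc₂ hc₁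
      (by simpa only [add_comm] using h₂) (by simpa only [add_comm] using h₁) h0₂ h0₁ hP).symm

end Transport

/-! ### Differentiating a transport equation across the characteristics -/

section Commute

variable {T : Set (ℝ × ℝ)} {u z f : ℝ × ℝ → ℝ} {a b : ℝ} {g : ℝ → ℝ}

/-- If `z_x + u z_y = f` with `u`, `z`, `f` of class `C¹`, then `z_y`, which is merely continuous,
is differentiable along the characteristics of slope `u`, with the derivative `f_y - u_y z_y`
obtained formally. The difference quotients of `z` between the characteristic and its vertical
translates have derivatives which do not involve second derivatives of `z`, and the claim follows
by passing to the limit in the fundamental theorem of calculus. -/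
lemma hasDerivWithinAt_dy_along (hT : IsOpen T) (hu : ContDiffOn ℝ 1 u T)
    (hz : ContDiffOn ℝ 1 z T) (hf : ContDiffOn ℝ 1 f T)
    (heq : ∀ P ∈ T, dx z P + u P * dy z P = f P) (hg : IsChar T u a b g) {t : ℝ}
    (ht : t ∈ Icc a b) :
    HasDerivWithinAt (fun s => dy z (s, g s))
      (dy f (t, g t) - dy u (t, g t) * dy z (t, g t)) (Icc a b) t := by
  have hgT : ∀ s ∈ Icc a b, (s, g s) ∈ T := fun s hs => (hg s hs).1
  have hcu := continuousOn_dy hT hu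
  have hcz := continuousOn_dy hT hz
  have hcf := continuousOn_dy hT hf
  obtain ⟨ρ, hρ, M, hM, htube⟩ := exists_tube hT
    (F := fun P => |dy u P| + |dy z P| + |dy f P|) ((hcu.abs.add hcz.abs).add hcf.abs)
    hg.continuousOn hgT
  have hbd : ∀ s ∈ Icc a b, ∀ y, |y - g s| ≤ ρ →
      (s, y) ∈ T ∧ |dy u (s, y)| ≤ M ∧ |dy z (s, y)| ≤ M ∧ |dy f (s, y)| ≤ M := by
    intro s hs y hy
    obtain ⟨h1, h2⟩ := htube s hs y hy
    have h3 := (le_abs_self _).trans h2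
    refine ⟨h1, ?_, ?_, ?_⟩ <;>
      linarith [abs_nonneg (dy u (s, y)), abs_nonneg (dy z (s, y)), abs_nonneg (dy f (s, y))]
  set h : ℕ → ℝ := fun n => ρ / (n + 1) with hh
  have hh0 : ∀ n, 0 < h n := fun n => by positivity
  have hhρ : ∀ n, h n ≤ ρ := fun n => div_le_self hρ.le (by linarith [n.cast_nonneg (α := ℝ)])
  have hhlim : Tendsto h atTop (𝓝[≠] 0) :=
    tendsto_nhdsWithin_iff.2 ⟨tendsto_const_div_atTop_nhds_zero_nat ρ |>.comp
      (tendsto_add_atTop_nat 1) |>.congr fun n => by simp [hh],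
      Eventually.of_forall fun n => (hh0 n).ne'⟩
  have hshift : ∀ n s, |g s + h n - g s| = h n := fun n s => by
    rw [add_sub_cancel_left, abs_of_pos (hh0 n)]
  have hsT : ∀ n, ∀ s ∈ Icc a b, (s, g s + h n) ∈ T := fun n s hs =>
    (hbd s hs _ (by rw [hshift]; exact hhρ n)).1
  -- difference quotients along the characteristic, and their derivatives
  set Z : ℕ → ℝ → ℝ := fun n s => (h n)⁻¹ * (z (s, g s + h n) - z (s, g s)) with hZ
  set r : ℕ → ℝ → ℝ := fun n s => (h n)⁻¹ * (f (s, g s + h n) - f (s, g s))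
    - (h n)⁻¹ * (u (s, g s + h n) - u (s, g s)) * dy z (s, g s + h n) with hr
  set R : ℝ → ℝ := fun s => dy f (s, g s) - dy u (s, g s) * dy z (s, g s) with hR
  have hZd : ∀ n, ∀ s ∈ Icc a b, HasDerivWithinAt (Z n) (r n s) (Icc a b) s := by
    intro n s hs
    have d1 := hasDerivWithinAt_along (g := fun s => g s + h n)
      (differentiableAt_of_contDiffOn hT hz one_ne_zero (hsT n s hs)) ((hg s hs).2.add_const _)
    have d2 := hasDerivWithinAt_along
      (differentiableAt_of_contDiffOn hT hz one_ne_zero (hgT s hs)) (hg s hs).2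
    refine ((d1.sub d2).const_mul _).congr_deriv ?_
    have e1 := heq _ (hsT n s hs)
    have e2 := heq _ (hgT s hs)
    simp only [hr, ← e1, ← e2]
    ring
  have hcomp : ∀ F : ℝ × ℝ → ℝ, ContinuousOn F T → ContinuousOn (fun s => F (s, g s)) (Icc a b) :=
    fun F hF => hF.comp (continuousOn_id.prodMk hg.continuousOn) hgT
  have hcomp' : ∀ F : ℝ × ℝ → ℝ, ContinuousOn F T → ∀ n,
      ContinuousOn (fun s => F (s, g s + h n)) (Icc a b) := fun F hF n =>
    hF.comp (continuousOn_id.prodMk (hg.continuousOn.add continuousOn_const)) (hsT n)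
  have hrc : ∀ n, ContinuousOn (r n) (Icc a b) := fun n =>
    (continuousOn_const.mul ((hcomp' f hf.continuousOn n).sub (hcomp f hf.continuousOn))).sub
      ((continuousOn_const.mul ((hcomp' u hu.continuousOn n).sub (hcomp u hu.continuousOn))).mul
        (hcomp' _ hcz n))
  have hRc : ContinuousOn R (Icc a b) :=
    (hcomp _ hcf).sub ((hcomp _ hcu).mul (hcomp _ hcz))
  have hquot : ∀ F : ℝ × ℝ → ℝ, ContDiffOn ℝ 1 F T → ∀ s ∈ Icc a b,
      Tendsto (fun n => (h n)⁻¹ * (F (s, g s + h n) - F (s, g s))) atTop (𝓝 (dy F (s, g s))) := by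
    intro F hF s hs
    have := (hasDerivAt_dy (P := (s, g s))
      (differentiableAt_of_contDiffOn hT hF one_ne_zero (hgT s hs))).tendsto_slope_zero
    exact this.comp hhlim
  have hrlim : ∀ s ∈ Icc a b, Tendsto (fun n => r n s) atTop (𝓝 (R s)) := by
    intro s hs
    refine (hquot f hf s hs).sub ((hquot u hu s hs).mul ?_)
    have hct : ContinuousAt (dy z) (s, g s) := hcz.continuousAt (hT.mem_nhds (hgT s hs))
    refine hct.tendsto.comp ?_
    refine tendsto_const_nhds.prodMk_nhds ?_
    have := (tendsto_const_nhds (x := g s)).add (hhlim.mono_right nhdsWithin_le_nhds)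
    simpa using this
  have hrb : ∀ n, ∀ s ∈ Icc a b, ‖r n s‖ ≤ M + M * M := by
    intro n s hs
    have q : ∀ F : ℝ × ℝ → ℝ, ContDiffOn ℝ 1 F T →
        (∀ y, |y - g s| ≤ ρ → (s, y) ∈ T ∧ |dy F (s, y)| ≤ M) →
        |(h n)⁻¹ * (F (s, g s + h n) - F (s, g s))| ≤ M := by
      intro F hF hFb
      have := abs_sub_le_of_dy_le hT hF hFb (y := g s + h n) (by rw [hshift]; exact hhρ n)
      rw [hshift] at this
      rw [abs_mul, abs_inv, abs_of_pos (hh0 n), inv_mul_le_iff₀ (hh0 n), mul_comm]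
      exact this
    have b1 := q f hf fun y hy => ⟨(hbd s hs y hy).1, (hbd s hs y hy).2.2.2⟩
    have b2 := q u hu fun y hy => ⟨(hbd s hs y hy).1, (hbd s hs y hy).2.1⟩
    have b3 := (hbd s hs (g s + h n) (by rw [hshift]; exact hhρ n)).2.2.1
    refine (norm_sub_le _ _).trans (add_le_add b1 ?_)
    rw [norm_mul]
    exact mul_le_mul b2 b3 (norm_nonneg _) hM
  have hint : ∀ s ∈ Icc a b, dy z (s, g s) - dy z (a, g a) = ∫ x in a..s, R x := by
    intro s hs
    have hsub : Icc a s ⊆ Icc a b := Icc_subset_Icc_right hs.2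
    have hsub' : uIoc a s ⊆ Icc a b := by
      rw [uIoc_of_le hs.1]; exact Ioc_subset_Icc_self.trans hsub
    have hftc : ∀ n, ∫ x in a..s, r n x = Z n s - Z n a := fun n =>
      intervalIntegral.integral_eq_sub_of_hasDerivAt_of_le hs.1
        (fun x hx => ((hZd n x (hsub hx)).mono hsub).continuousWithinAt)
        (fun x hx => (hZd n x (hsub (Ioo_subset_Icc_self hx))).hasDerivAt
          (Icc_mem_nhds hx.1 (hx.2.trans_le hs.2)))
        (((hrc n).mono hsub).intervalIntegrable_of_Icc hs.1)
    have l1 : Tendsto (fun n => ∫ x in a..s, r n x) atTop (𝓝 (∫ x in a..s, R x)) := by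
      refine intervalIntegral.tendsto_integral_filter_of_dominated_convergence
        (fun _ => M + M * M) ?_ ?_ intervalIntegrable_const ?_
      · exact Eventually.of_forall fun n =>
          ((hrc n).mono hsub').aestronglyMeasurable measurableSet_uIoc
      · exact Eventually.of_forall fun n => Eventually.of_forall fun x hx => hrb n x (hsub' hx)
      · exact Eventually.of_forall fun x hx => hrlim x (hsub' hx)
    have l2 : Tendsto (fun n => ∫ x in a..s, r n x) atTop
        (𝓝 (dy z (s, g s) - dy z (a, g a))) := by
      simp only [hftc]
      exact (hquot z hz s hs).sub (hquot z hz a ⟨le_rfl, hs.1.trans hs.2⟩)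
    exact tendsto_nhds_unique l2 l1
  have hder : HasDerivWithinAt (fun s => ∫ x in a..s, R x) (R t) (Icc a b) t := by
    have : Fact (t ∈ Icc a b) := ⟨ht⟩
    exact intervalIntegral.integral_hasDerivWithinAt_right
      ((hRc.mono (Icc_subset_Icc_right ht.2)).intervalIntegrable_of_Icc ht.1)
      (hRc.stronglyMeasurableAtFilter_nhdsWithin measurableSet_Icc t) (hRc t ht)
  refine (hder.const_add (dy z (a, g a))).congr (fun s hs => ?_) ?_
  · rw [← hint s hs]; ring
  · rw [← hint t ht]; ring

end Commute

/-! ### Algebra of the coefficients -/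

namespace Coeffs

variable (c : Coeffs) (w : Fin 5 → ℝ)

/-- The right-hand side of the equation for `u₁`. -/
noncomputable def rhs₁ (u₁ u₂ : ℝ) : ℝ :=
  c.E0 w + c.E1 w * u₁ + c.E2 w * u₂ + c.E3 w * u₁ ^ 2 + c.E4 w * u₁ * u₂ + c.E5 w * u₁ ^ 2 * u₂

/-- The right-hand side of the equation for `u₂`. -/
noncomputable def rhs₂ (u₁ u₂ : ℝ) : ℝ :=
  c.E0 w + c.I1 w * u₁ + c.I2 w * u₂ + c.I3 w * u₂ ^ 2 + c.I4 w * u₁ * u₂ + c.E5 w * u₁ * u₂ ^ 2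

/-- The quotient of the difference of the right-hand sides for `u₁` and `u₂` by `u₁ - u₂`. -/
noncomputable def rhsQuot (u₁ u₂ : ℝ) : ℝ :=
  c.E1 w - c.I1 w + c.E3 w * u₁ + c.I3 w * u₂ + c.E5 w * u₁ * u₂

lemma rhs₁_sub_rhs₂ (u₁ u₂ : ℝ) :
    c.rhs₁ w u₁ u₂ - c.rhs₂ w u₁ u₂ = (u₁ - u₂) * c.rhsQuot w u₁ u₂ := by
  have h1 : c.E2 w - c.I2 w = -(c.E1 w - c.I1 w) := by unfold E1 E2 I1 I2; ring
  have h2 : c.E4 w - c.I4 w = c.I3 w - c.E3 w := by unfold E3 E4 I3 I4; ring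
  unfold rhs₁ rhs₂ rhsQuot
  linear_combination u₂ * h1 + u₁ * u₂ * h2

variable {c w}

lemma delta_mul_rhsQuot (hΔ : c.Delta w ≠ 0) (u₁ u₂ : ℝ) :
    4 * (c.Delta w * c.rhsQuot w u₁ u₂) =
      4 * (pd 0 c.Delta w + pd 2 c.Delta w * w 3 - c.D w * pd 3 c.Delta w)
      + 2 * (c.C w * pd 4 c.Delta w - c.Delta w * pd 4 c.C w)
      + u₁ * (-(2 * (2 * pd 0 c.B w + pd 1 c.C w + 2 * pd 2 c.B w * w 3 + pd 2 c.C w * w 4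
          + c.C w * pd 4 c.B w - c.B w * pd 4 c.C w - 2 * c.D w * pd 3 c.B w))
        + 2 * (pd 1 c.Delta w + pd 2 c.Delta w * w 4 - c.B w * pd 4 c.Delta w)
        + (- c.C w * pd 3 c.C w + c.Delta w * pd 3 c.C w + c.C w * pd 3 c.Delta w
          - c.Delta w * pd 3 c.Delta w + 2 * c.Delta w * pd 4 c.B w))
      + u₂ * (2 * (2 * pd 0 c.B w + pd 1 c.C w + 2 * pd 2 c.B w * w 3 + pd 2 c.C w * w 4
          + c.C w * pd 4 c.B w - c.B w * pd 4 c.C w - 2 * c.D w * pd 3 c.B w)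
        + 2 * (pd 1 c.Delta w + pd 2 c.Delta w * w 4 - c.B w * pd 4 c.Delta w)
        + (c.C w * pd 3 c.C w + c.Delta w * pd 3 c.C w + c.C w * pd 3 c.Delta w
          + c.Delta w * pd 3 c.Delta w + 2 * c.Delta w * pd 4 c.B w))
      - 4 * c.Delta w * pd 3 c.B w * u₁ * u₂ := by
  unfold rhsQuot E1 I1 E3 I3 E5 alpha1 alpha2 beta1 beta2
  field_simp
  ring

lemma delta_mul_rhs₂ (hΔ : c.Delta w ≠ 0) (u₁ u₂ : ℝ) :
    4 * (c.Delta w * c.rhs₂ w u₁ u₂) =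
      4 * c.Delta w * pd 4 c.D w
      + u₁ * (2 * (2 * pd 1 c.D w + pd 0 c.C w + 2 * pd 2 c.D w * w 4 + pd 2 c.C w * w 3
          + c.C w * pd 3 c.D w - c.D w * pd 3 c.C w - 2 * c.B w * pd 4 c.D w)
        - 2 * (pd 0 c.Delta w + pd 2 c.Delta w * w 3 - c.D w * pd 3 c.Delta w)
        + (c.C w * pd 4 c.C w - c.Delta w * pd 4 c.C w - c.C w * pd 4 c.Delta w
          + c.Delta w * pd 4 c.Delta w - 2 * c.Delta w * pd 3 c.D w))
      + u₂ * (-(2 * (2 * pd 1 c.D w + pd 0 c.C w + 2 * pd 2 c.D w * w 4 + pd 2 c.C w * w 3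
          + c.C w * pd 3 c.D w - c.D w * pd 3 c.C w - 2 * c.B w * pd 4 c.D w))
        + 2 * (pd 0 c.Delta w + pd 2 c.Delta w * w 3 - c.D w * pd 3 c.Delta w)
        + (- c.C w * pd 4 c.C w - 3 * c.Delta w * pd 4 c.C w + c.C w * pd 4 c.Delta w
          - c.Delta w * pd 4 c.Delta w - 2 * c.Delta w * pd 3 c.D w))
      + u₂ ^ 2 * (2 * (2 * pd 0 c.B w + pd 1 c.C w + 2 * pd 2 c.B w * w 3 + pd 2 c.C w * w 4
          + c.C w * pd 4 c.B w - c.B w * pd 4 c.C w - 2 * c.D w * pd 3 c.B w)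
        + 2 * (pd 1 c.Delta w + pd 2 c.Delta w * w 4 - c.B w * pd 4 c.Delta w)
        + (c.C w * pd 3 c.C w + c.Delta w * pd 3 c.C w + c.C w * pd 3 c.Delta w
          + c.Delta w * pd 3 c.Delta w + 2 * c.Delta w * pd 4 c.B w))
      + u₁ * u₂ * (-(2 * (2 * pd 0 c.B w + pd 1 c.C w + 2 * pd 2 c.B w * w 3 + pd 2 c.C w * w 4
          + c.C w * pd 4 c.B w - c.B w * pd 4 c.C w - 2 * c.D w * pd 3 c.B w))
        - 2 * (pd 1 c.Delta w + pd 2 c.Delta w * w 4 - c.B w * pd 4 c.Delta w)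
        + (- c.C w * pd 3 c.C w + 3 * c.Delta w * pd 3 c.C w - c.C w * pd 3 c.Delta w
          - c.Delta w * pd 3 c.Delta w + 2 * c.Delta w * pd 4 c.B w))
      - 4 * c.Delta w * pd 3 c.B w * u₁ * u₂ ^ 2 := by
  unfold rhs₂ E0 I1 I2 I3 I4 E5 alpha1 alpha2 beta1 beta2
  field_simp
  ring

end Coeffs

/-- The derivative of `F(x, y, z, p, q)` in a direction in which `x`, `y`, `z`, `p`, `q` grow at
the rates `x'`, `y'`, `z'`, `p'`, `q'`. -/
noncomputable def rate (F : (Fin 5 → ℝ) → ℝ) (w : Fin 5 → ℝ) (x' y' z' p' q' : ℝ) : ℝ :=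
  x' * pd 0 F w + y' * pd 1 F w + z' * pd 2 F w + p' * pd 3 F w + q' * pd 4 F w

namespace Coeffs

variable {c : Coeffs} {w : Fin 5 → ℝ}

/-- The formal derivative of `Δ - (u₁ - u₂) (q_y + B)` along the characteristics of slope `u₁` is a
linear combination of the defects. -/
lemma defect_identity₁ (hΔ : c.Delta w ≠ 0) {u₁ u₂ u₁x u₁y u₂x u₂y zx zy px py qx qy : ℝ}
    (hu₁ : u₁x + u₂ * u₁y = c.rhs₁ w u₁ u₂) (hu₂ : u₂x + u₁ * u₂y = c.rhs₂ w u₁ u₂)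
    (hz : zx + u₁ * zy = w 3 + u₁ * w 4)
    (hp : px + u₂ * py = (c.C w + c.Delta w) / 2 * u₂ - c.D w)
    (hq : qx + u₁ * qy = (c.C w + c.Delta w) / 2 - c.B w * u₁) :
    rate c.Delta w 1 0 zx px qx + u₁ * rate c.Delta w 0 1 zy py qy
      - ((u₁x + u₁ * u₁y - (u₂x + u₁ * u₂y)) * (qy + c.B w)
        + (u₁ - u₂) * (((rate c.C w 0 1 zy py qy + rate c.Delta w 0 1 zy py qy) / 2
            - (rate c.B w 0 1 zy py qy * u₁ + c.B w * u₁y) - u₁y * qy)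
          + (rate c.B w 1 0 zx px qx + u₁ * rate c.B w 0 1 zy py qy))) =
    -((u₁ - u₂) * ((pd 2 c.C w + pd 2 c.Delta w) / 2 - u₁ * pd 2 c.B w)) * (zy - w 4)
      + (c.rhsQuot w u₁ u₂ + (pd 4 c.C w + pd 4 c.Delta w) / 2 - u₁ * pd 4 c.B w)
        * (c.Delta w - (u₁ - u₂) * (qy + c.B w))
      + (pd 3 c.Delta w - (pd 3 c.C w + pd 3 c.Delta w) / 2 + u₂ * pd 3 c.B w)
        * ((u₁ - u₂) * py + (c.C w + c.Delta w) / 2 * u₂ - (c.C w - c.Delta w) / 2 * u₁) := by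
  have hG := delta_mul_rhsQuot hΔ u₁ u₂
  have h12 := c.rhs₁_sub_rhs₂ w u₁ u₂
  obtain rfl : zx = w 3 + u₁ * w 4 - u₁ * zy := by linarith
  obtain rfl : px = (c.C w + c.Delta w) / 2 * u₂ - c.D w - u₂ * py := by linarith
  obtain rfl : qx = (c.C w + c.Delta w) / 2 - c.B w * u₁ - u₁ * qy := by linarith
  unfold rate
  linear_combination (-(qy + c.B w)) * (hu₁ - hu₂ + h12) - hG / 4

/-- The formal derivative of `(u₁ - u₂) p_y + (C + Δ) / 2 u₂ - (C - Δ) / 2 u₁` along the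
characteristics of slope `u₂` is a linear combination of the defects. -/
lemma defect_identity₂ (hΔ : c.Delta w ≠ 0) {u₁ u₂ u₁x u₁y u₂x u₂y zx zy px py qx qy : ℝ}
    (hu₁ : u₁x + u₂ * u₁y = c.rhs₁ w u₁ u₂) (hu₂ : u₂x + u₁ * u₂y = c.rhs₂ w u₁ u₂)
    (hz : zx + u₁ * zy = w 3 + u₁ * w 4)
    (hp : px + u₂ * py = (c.C w + c.Delta w) / 2 * u₂ - c.D w)
    (hq : qx + u₁ * qy = (c.C w + c.Delta w) / 2 - c.B w * u₁) :
    (u₁x + u₂ * u₁y - (u₂x + u₂ * u₂y)) * py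
      + (u₁ - u₂) * ((rate c.C w 0 1 zy py qy + rate c.Delta w 0 1 zy py qy) / 2 * u₂
          + (c.C w + c.Delta w) / 2 * u₂y - rate c.D w 0 1 zy py qy - u₂y * py)
      + ((rate c.C w 1 0 zx px qx + u₂ * rate c.C w 0 1 zy py qy
            + (rate c.Delta w 1 0 zx px qx + u₂ * rate c.Delta w 0 1 zy py qy)) / 2 * u₂
          + (c.C w + c.Delta w) / 2 * (u₂x + u₂ * u₂y))
      - ((rate c.C w 1 0 zx px qx + u₂ * rate c.C w 0 1 zy py qy
            - (rate c.Delta w 1 0 zx px qx + u₂ * rate c.Delta w 0 1 zy py qy)) / 2 * u₁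
          + (c.C w - c.Delta w) / 2 * (u₁x + u₂ * u₁y)) =
    (u₁ - u₂) * (u₁ * ((pd 2 c.C w - pd 2 c.Delta w) / 2) - pd 2 c.D w) * (zy - w 4)
      + (pd 4 c.D w - u₁ * ((pd 4 c.C w - pd 4 c.Delta w) / 2))
        * (c.Delta w - (u₁ - u₂) * (qy + c.B w))
      + (c.rhsQuot w u₁ u₂ + u₂ * ((pd 3 c.C w + pd 3 c.Delta w) / 2) - pd 3 c.D w)
        * ((u₁ - u₂) * py + (c.C w + c.Delta w) / 2 * u₂ - (c.C w - c.Delta w) / 2 * u₁) := by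
  have hG := delta_mul_rhsQuot hΔ u₁ u₂
  have hF := delta_mul_rhs₂ hΔ u₁ u₂
  have h12 := c.rhs₁_sub_rhs₂ w u₁ u₂
  obtain rfl : zx = w 3 + u₁ * w 4 - u₁ * zy := by linarith
  obtain rfl : px = (c.C w + c.Delta w) / 2 * u₂ - c.D w - u₂ * py := by linarith
  obtain rfl : qx = (c.C w + c.Delta w) / 2 - c.B w * u₁ - u₁ * qy := by linarith
  unfold rate
  linear_combination (py - (c.C w - c.Delta w) / 2) * (hu₁ + h12)
    + (-py + (c.C w + c.Delta w) / 2) * hu₂ + hF / 4 - u₂ * hG / 4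

end Coeffs

/-! ### Coefficients along a solution -/

/-- The point `(x, y, z(x,y), p(x,y), q(x,y))` of `ℝ⁵`. -/
def jet (z p q : ℝ × ℝ → ℝ) (P : ℝ × ℝ) : Fin 5 → ℝ := pt P.1 P.2 (z P) (p P) (q P)

section Jet

variable {T : Set (ℝ × ℝ)} {z p q : ℝ × ℝ → ℝ} {F : (Fin 5 → ℝ) → ℝ} {P : ℝ × ℝ}

lemma contDiffOn_jet {n : WithTop ℕ∞} (hz : ContDiffOn ℝ n z T) (hp : ContDiffOn ℝ n p T)
    (hq : ContDiffOn ℝ n q T) : ContDiffOn ℝ n (jet z p q) T := by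
  rw [contDiffOn_pi]
  intro i
  fin_cases i
  exacts [contDiffOn_fst, contDiffOn_snd, hz, hp, hq]

lemma contDiffOn_comp_jet {n : WithTop ℕ∞} (hF : ∀ P ∈ T, ContDiffAt ℝ n F (jet z p q P))
    (hz : ContDiffOn ℝ n z T) (hp : ContDiffOn ℝ n p T) (hq : ContDiffOn ℝ n q T) :
    ContDiffOn ℝ n (fun P => F (jet z p q P)) T := fun P hP =>
  (hF P hP).comp_contDiffWithinAt P (contDiffOn_jet hz hp hq P hP)

lemma continuousAt_pd {w : Fin 5 → ℝ} (hF : ContDiffAt ℝ 2 F w) (i : Fin 5) :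
    ContinuousAt (pd i F) w :=
  (hF.continuousAt_fderiv two_ne_zero).clm_apply continuousAt_const

lemma fderiv_eq_sum_pd (F : (Fin 5 → ℝ) → ℝ) (w v : Fin 5 → ℝ) :
    fderiv ℝ F w v = ∑ i, v i * pd i F w := by
  conv_lhs => rw [pi_eq_sum_univ' v]
  simp only [map_sum, map_smul, smul_eq_mul, pd]

lemma fderiv_comp_jet (hF : DifferentiableAt ℝ F (jet z p q P)) (hz : DifferentiableAt ℝ z P)
    (hp : DifferentiableAt ℝ p P) (hq : DifferentiableAt ℝ q P) (v : ℝ × ℝ) :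
    fderiv ℝ (fun P => F (jet z p q P)) P v =
      rate F (jet z p q P) v.1 v.2 (fderiv ℝ z P v) (fderiv ℝ p P v) (fderiv ℝ q P v) := by
  have hj : HasFDerivAt (jet z p q) (ContinuousLinearMap.pi
      ![ContinuousLinearMap.fst ℝ ℝ ℝ, ContinuousLinearMap.snd ℝ ℝ ℝ, fderiv ℝ z P, fderiv ℝ p P,
        fderiv ℝ q P]) P := by
    rw [hasFDerivAt_pi]
    intro i
    fin_cases i
    exacts [hasFDerivAt_fst, hasFDerivAt_snd, hz.hasFDerivAt, hp.hasFDerivAt, hq.hasFDerivAt]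
  have hcomp := hF.hasFDerivAt.comp P hj
  rw [show (fun P => F (jet z p q P)) = F ∘ jet z p q from rfl, hcomp.fderiv,
    ContinuousLinearMap.comp_apply, fderiv_eq_sum_pd, Fin.sum_univ_five]
  rfl

lemma dx_comp_jet (hF : DifferentiableAt ℝ F (jet z p q P)) (hz : DifferentiableAt ℝ z P)
    (hp : DifferentiableAt ℝ p P) (hq : DifferentiableAt ℝ q P) :
    dx (fun P => F (jet z p q P)) P = rate F (jet z p q P) 1 0 (dx z P) (dx p P) (dx q P) :=
  fderiv_comp_jet hF hz hp hq (1, 0)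

lemma dy_comp_jet (hF : DifferentiableAt ℝ F (jet z p q P)) (hz : DifferentiableAt ℝ z P)
    (hp : DifferentiableAt ℝ p P) (hq : DifferentiableAt ℝ q P) :
    dy (fun P => F (jet z p q P)) P = rate F (jet z p q P) 0 1 (dy z P) (dy p P) (dy q P) :=
  fderiv_comp_jet hF hz hp hq (0, 1)

end Jet

namespace Coeffs

variable {c : Coeffs} {w : Fin 5 → ℝ}

lemma disc_pos_of_delta_pos (hw : 0 < c.Delta w) : 0 < c.disc w := Real.sqrt_pos.1 hw

lemma IsC2.contDiffAt_Delta (hc : c.IsC2) (hw : 0 < c.Delta w) : ContDiffAt ℝ 2 c.Delta w := by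
  obtain ⟨hA, hB, hC, hD⟩ := hc
  have : ContDiff ℝ 2 c.disc := by unfold disc; fun_prop
  exact this.contDiffAt.sqrt (disc_pos_of_delta_pos hw).ne'

lemma IsC2.continuousAt_rhsQuot (hc : c.IsC2) (hw : 0 < c.Delta w) (u₁ u₂ : ℝ) :
    ContinuousAt (fun x : (Fin 5 → ℝ) × ℝ × ℝ => c.rhsQuot x.1 x.2.1 x.2.2) (w, u₁, u₂) := by
  have hΔ := hc.contDiffAt_Delta hw
  obtain ⟨hA, hB, hC, hD⟩ := hc
  have hpd : ∀ {F : (Fin 5 → ℝ) → ℝ}, ContDiffAt ℝ 2 F w → ∀ i,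
      ContinuousAt (fun x : (Fin 5 → ℝ) × ℝ × ℝ => pd i F x.1) (w, u₁, u₂) := fun hF i =>
    ContinuousAt.comp (f := Prod.fst) (x := (w, u₁, u₂)) (continuousAt_pd hF i) continuousAt_fst
  have hco : ∀ {F : (Fin 5 → ℝ) → ℝ}, ContDiffAt ℝ 2 F w →
      ContinuousAt (fun x : (Fin 5 → ℝ) × ℝ × ℝ => F x.1) (w, u₁, u₂) := fun hF =>
    ContinuousAt.comp (f := Prod.fst) (x := (w, u₁, u₂)) hF.continuousAt continuousAt_fst
  have b := hco hB.contDiffAt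
  have b0 := hpd hB.contDiffAt 0
  have b2 := hpd hB.contDiffAt 2
  have b3 := hpd hB.contDiffAt 3
  have b4 := hpd hB.contDiffAt 4
  have k := hco hC.contDiffAt
  have k0 := hpd hC.contDiffAt 0
  have k1 := hpd hC.contDiffAt 1
  have k2 := hpd hC.contDiffAt 2
  have k3 := hpd hC.contDiffAt 3
  have k4 := hpd hC.contDiffAt 4
  have d := hco hD.contDiffAt
  have d1 := hpd hD.contDiffAt 1
  have d2 := hpd hD.contDiffAt 2
  have d3 := hpd hD.contDiffAt 3
  have d4 := hpd hD.contDiffAt 4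
  have e := hco hΔ
  have e0 := hpd hΔ 0
  have e1 := hpd hΔ 1
  have e2 := hpd hΔ 2
  have e3 := hpd hΔ 3
  have e4 := hpd hΔ 4
  have i2 : ContinuousAt (fun x : (Fin 5 → ℝ) × ℝ × ℝ => 1 / (2 * c.Delta x.1)) (w, u₁, u₂) :=
    continuousAt_const.div (continuousAt_const.mul e) (by positivity)
  have i4 : ContinuousAt (fun x : (Fin 5 → ℝ) × ℝ × ℝ => 1 / (4 * c.Delta x.1)) (w, u₁, u₂) :=
    continuousAt_const.div (continuousAt_const.mul e) (by positivity)
  unfold rhsQuot E1 I1 E3 I3 E5 alpha1 alpha2 beta1 beta2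
  fun_prop

end Coeffs

/-! ### The defects of a solution and their transport equations -/

section Nonvanishing

variable {E : Type*} [NormedAddCommGroup E] [NormedSpace ℝ E] {T : Set (ℝ × ℝ)}
  {u : ℝ × ℝ → ℝ} {Φ : ℝ × ℝ → E} {A : ℝ × ℝ → ℝ}

lemma IsTransported.axis_eq_zero (hA : ContinuousOn A T)
    (hΦ : IsTransported T u Φ fun P => A P * ‖Φ P‖) {a : ℝ} (ha : a ≤ 0) {g : ℝ → ℝ}
    (hg : IsChar T u a 0 g) (h0 : Φ (a, g a) = 0) : Φ (0, g 0) = 0 := by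
  choose! d hd hdr using hΦ a 0 g hg
  obtain ⟨M, hM⟩ := isCompact_Icc.exists_bound_of_continuousOn
    (hA.comp (continuousOn_id.prodMk hg.continuousOn) fun t ht => (hg t ht).1)
  refine eq_zero_of_abs_deriv_le_mul_abs_self_of_eq_zero_right (f := fun t => Φ (t, g t)) (f' := d)
    (K := M) (a := a) (b := 0) (fun t ht => (hd t ht).continuousWithinAt)
    (fun t ht => hasDerivWithinAt_Ici_of_Icc (hd t (Ico_subset_Icc_self ht)) ht) h0
    (fun t ht => ?_) 0 ⟨ha, le_rfl⟩
  have ht' := Ico_subset_Icc_self ht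
  exact (hdr t ht').trans (mul_le_mul_of_nonneg_right ((le_abs_self _).trans (hM t ht'))
    (norm_nonneg _))

/-- A function that satisfies a linear homogeneous differential inequality along characteristics
reaching the axis vanishes nowhere if it vanishes nowhere on the axis. -/
lemma IsTransported.ne_zero (hT : CharacteristicsReachAxis T u) (hA : ContinuousOn A T)
    (hΦ : IsTransported T u Φ fun P => A P * ‖Φ P‖) (hne : ∀ y, (0, y) ∈ T → Φ (0, y) ≠ 0)
    {P : ℝ × ℝ} (hP : P ∈ T) : Φ P ≠ 0 := by
  intro hP0
  rcases le_total P.1 0 with hx | hx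
  · obtain ⟨g, hg, hgP⟩ := reachesAxis_of_characteristicsReachAxis hT P hP hx
    exact hne _ (hg 0 ⟨hx, le_rfl⟩).1 (hΦ.axis_eq_zero hA hx hg (by rw [hgP]; exact hP0))
  · have hPr : reflect P ∈ reflect ⁻¹' T := by simpa [reflect] using hP
    have hxr : (reflect P).1 ≤ 0 := by simpa [reflect] using hx
    obtain ⟨g, hg, hgP⟩ := reachesAxis_reflect hT _ hPr hxr
    have h0 := hΦ.comp_reflect.axis_eq_zero
      (hA.comp (contDiff_reflect (n := 0)).continuous.continuousOn fun _ h => h) hxr hg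
      (by rw [hgP]; simpa [reflect] using hP0)
    have hmem := (hg 0 ⟨hxr, le_rfl⟩).1
    simp only [reflect, mem_preimage, neg_zero] at h0 hmem
    exact hne _ hmem h0

end Nonvanishing

/-- The defect of the relation `z_y = q`. -/
noncomputable def defectZ (z q : ℝ × ℝ → ℝ) (P : ℝ × ℝ) : ℝ := dy z P - q P

namespace Coeffs

/-- The defect of the relation `(u₁ - u₂) (q_y + B) = Δ`, which together with the equation for `q`
is equivalent to `q_x + u₂ q_y = (C - Δ) / 2 - B u₂`. -/
noncomputable def defectQ (c : Coeffs) (u₁ u₂ z p q : ℝ × ℝ → ℝ) (P : ℝ × ℝ) : ℝ :=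
  c.Delta (jet z p q P) - (u₁ P - u₂ P) * (dy q P + c.B (jet z p q P))

/-- The defect of the relation `(u₁ - u₂) p_y = (C - Δ) / 2 u₁ - (C + Δ) / 2 u₂`, which together
with the equation for `p` is equivalent to `p_x + u₁ p_y = (C - Δ) / 2 u₁ - D`. -/
noncomputable def defectP (c : Coeffs) (u₁ u₂ z p q : ℝ × ℝ → ℝ) (P : ℝ × ℝ) : ℝ :=
  (u₁ P - u₂ P) * dy p P + (c.C (jet z p q P) + c.Delta (jet z p q P)) / 2 * u₂ P
    - (c.C (jet z p q P) - c.Delta (jet z p q P)) / 2 * u₁ P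

section Solution

variable {c : Coeffs} {T : Set (ℝ × ℝ)} {u₁ u₂ z p q : ℝ × ℝ → ℝ}

lemma contDiffAt_coeffs (hc : c.IsC2) {w : Fin 5 → ℝ} (hw : 0 < c.Delta w) :
    ContDiffAt ℝ 2 c.B w ∧ ContDiffAt ℝ 2 c.C w ∧ ContDiffAt ℝ 2 c.D w ∧
      ContDiffAt ℝ 2 c.Delta w :=
  ⟨hc.2.1.contDiffAt, hc.2.2.1.contDiffAt, hc.2.2.2.contDiffAt, hc.contDiffAt_Delta hw⟩

lemma IsRiemannSolution.continuousOn_pd (hsol : c.IsRiemannSolution T u₁ u₂ z p q)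
    {F : (Fin 5 → ℝ) → ℝ} (hF : ∀ P ∈ T, ContDiffAt ℝ 2 F (jet z p q P)) (i : Fin 5) :
    ContinuousOn (fun P => pd i F (jet z p q P)) T := fun P hP =>
  (continuousAt_pd (hF P hP) i).comp_continuousWithinAt
    ((contDiffOn_jet hsol.contDiffOn_z hsol.contDiffOn_p hsol.contDiffOn_q).continuousOn P hP)

lemma IsRiemannSolution.contDiffOn_coeff (hsol : c.IsRiemannSolution T u₁ u₂ z p q)
    {F : (Fin 5 → ℝ) → ℝ} (hF : ∀ P ∈ T, ContDiffAt ℝ 2 F (jet z p q P)) :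
    ContDiffOn ℝ 1 (fun P => F (jet z p q P)) T :=
  contDiffOn_comp_jet (fun P hP => (hF P hP).of_le one_le_two) hsol.contDiffOn_z
    hsol.contDiffOn_p hsol.contDiffOn_q

lemma IsRiemannSolution.continuousOn_rhsQuot (hc : c.IsC2)
    (hsol : c.IsRiemannSolution T u₁ u₂ z p q) (hΔ : ∀ P ∈ T, 0 < c.Delta (jet z p q P)) :
    ContinuousOn (fun P => c.rhsQuot (jet z p q P) (u₁ P) (u₂ P)) T := fun P hP =>
  ContinuousAt.comp_continuousWithinAt (f := fun P => (jet z p q P, u₁ P, u₂ P))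
    (hc.continuousAt_rhsQuot (hΔ P hP) (u₁ P) (u₂ P))
    (((contDiffOn_jet hsol.contDiffOn_z hsol.contDiffOn_p hsol.contDiffOn_q).continuousOn P hP
      ).prodMk ((hsol.contDiffOn_u₁.continuousOn P hP).prodMk
        (hsol.contDiffOn_u₂.continuousOn P hP)))

/-- The families of characteristics are everywhere distinct, because `u₁ - u₂` satisfies a linear
homogeneous equation along the characteristics of slope `u₁`. -/
lemma IsRiemannSolution.slopes_ne (hT : IsOpen T) (hc : c.IsC2)
    (hsol : c.IsRiemannSolution T u₁ u₂ z p q) (hΔ : ∀ P ∈ T, 0 < c.Delta (jet z p q P))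
    (hdet : CharacteristicsReachAxis T u₁) (h0 : ∀ y, (0, y) ∈ T → u₁ (0, y) ≠ u₂ (0, y))
    {P : ℝ × ℝ} (hP : P ∈ T) : u₁ P ≠ u₂ P := by
  refine sub_ne_zero.1 (IsTransported.ne_zero (Φ := fun P => u₁ P - u₂ P)
    (A := fun P => |c.rhsQuot (jet z p q P) (u₁ P) (u₂ P) + dy u₁ P|) hdet
    ((hsol.continuousOn_rhsQuot hc hΔ).add (continuousOn_dy hT hsol.contDiffOn_u₁)).abs ?_
    (fun y hy => sub_ne_zero.2 (h0 y hy)) hP)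
  intro a b g hg t ht
  obtain ⟨hmem, hd⟩ := hg t ht
  refine ⟨_, (hasDerivWithinAt_along
      (differentiableAt_of_contDiffOn hT hsol.contDiffOn_u₁ one_ne_zero hmem) hd).sub
    (hasDerivWithinAt_along
      (differentiableAt_of_contDiffOn hT hsol.contDiffOn_u₂ one_ne_zero hmem) hd), le_of_eq ?_⟩
  simp only [Real.norm_eq_abs, ← abs_mul]
  congr 1
  have h1 := hsol.eq_u₁ _ hmem _ rfl
  have h2 := hsol.eq_u₂ _ hmem _ rfl
  have h12 := c.rhs₁_sub_rhs₂ (jet z p q (t, g t)) (u₁ (t, g t)) (u₂ (t, g t))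
  simp only [rhs₁, rhs₂, jet] at h12 ⊢
  linear_combination h1 - h2 + h12

/-- The characteristic derivative of `z_y - q`. -/
lemma IsRiemannSolution.hasDerivWithinAt_defectZ (hT : IsOpen T)
    (hsol : c.IsRiemannSolution T u₁ u₂ z p q) (hne : ∀ P ∈ T, u₁ P ≠ u₂ P) {a b : ℝ}
    {g : ℝ → ℝ} (hg : IsChar T u₁ a b g) {t : ℝ} (ht : t ∈ Icc a b) :
    HasDerivWithinAt (fun s => defectZ z q (s, g s))
      (-dy u₁ (t, g t) * defectZ z q (t, g t)
        + -(u₁ (t, g t) / (u₁ (t, g t) - u₂ (t, g t))) * c.defectQ u₁ u₂ z p q (t, g t)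
        + 1 / (u₁ (t, g t) - u₂ (t, g t)) * c.defectP u₁ u₂ z p q (t, g t)) (Icc a b) t := by
  obtain ⟨hmem, hd⟩ := hg t ht
  have du₁ := differentiableAt_of_contDiffOn hT hsol.contDiffOn_u₁ one_ne_zero hmem
  have dp := differentiableAt_of_contDiffOn hT hsol.contDiffOn_p one_ne_zero hmem
  have dq := differentiableAt_of_contDiffOn hT hsol.contDiffOn_q one_ne_zero hmem
  have hf : ContDiffOn ℝ 1 (fun P => p P + u₁ P * q P) T :=
    hsol.contDiffOn_p.add (hsol.contDiffOn_u₁.mul hsol.contDiffOn_q)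
  have hfy : dy (fun P => p P + u₁ P * q P) (t, g t) =
      dy p (t, g t) + (dy u₁ (t, g t) * q (t, g t) + u₁ (t, g t) * dy q (t, g t)) :=
    (hasDerivAt_dy (differentiableAt_of_contDiffOn hT hf one_ne_zero hmem)).unique
      ((hasDerivAt_dy dp).add ((hasDerivAt_dy du₁).mul (hasDerivAt_dy dq)))
  have h := (hasDerivWithinAt_dy_along hT hsol.contDiffOn_u₁ hsol.contDiffOn_z hf hsol.eq_z hg
    ht).sub (hasDerivWithinAt_along dq hd)
  refine h.congr_deriv ?_
  have hs : u₁ (t, g t) - u₂ (t, g t) ≠ 0 := sub_ne_zero.2 (hne _ hmem)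
  have hq := hsol.eq_q _ hmem _ rfl
  simp only at hq
  simp only [hfy, defectZ, defectQ, defectP, jet]
  field_simp
  linear_combination -2 * (u₁ (t, g t) - u₂ (t, g t)) * hq

/-- The characteristic derivative of `Δ - (u₁ - u₂) (q_y + B)`. -/
lemma IsRiemannSolution.hasDerivWithinAt_defectQ (hT : IsOpen T) (hc : c.IsC2)
    (hsol : c.IsRiemannSolution T u₁ u₂ z p q) (hΔ : ∀ P ∈ T, 0 < c.Delta (jet z p q P))
    {a b : ℝ} {g : ℝ → ℝ} (hg : IsChar T u₁ a b g) {t : ℝ} (ht : t ∈ Icc a b) {P : ℝ × ℝ}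
    (hP : P = (t, g t)) {w : Fin 5 → ℝ} (hw : w = jet z p q P) :
    HasDerivWithinAt (fun s => c.defectQ u₁ u₂ z p q (s, g s))
      (-((u₁ P - u₂ P) * ((pd 2 c.C w + pd 2 c.Delta w) / 2 - u₁ P * pd 2 c.B w))
          * defectZ z q P
        + (c.rhsQuot w (u₁ P) (u₂ P) + (pd 4 c.C w + pd 4 c.Delta w) / 2 - u₁ P * pd 4 c.B w)
          * c.defectQ u₁ u₂ z p q P
        + (pd 3 c.Delta w - (pd 3 c.C w + pd 3 c.Delta w) / 2 + u₂ P * pd 3 c.B w)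
          * c.defectP u₁ u₂ z p q P) (Icc a b) t := by
  obtain ⟨hmem, hd⟩ := hg t ht
  rw [← hP] at hmem hd
  have dif : ∀ {f : ℝ × ℝ → ℝ}, ContDiffOn ℝ 1 f T → DifferentiableAt ℝ f P := fun hf =>
    differentiableAt_of_contDiffOn hT hf one_ne_zero hmem
  have along : ∀ {f : ℝ × ℝ → ℝ}, ContDiffOn ℝ 1 f T →
      HasDerivWithinAt (fun s => f (s, g s)) (dx f P + u₁ P * dy f P) (Icc a b) t := fun hf => by
    subst hP; exact hasDerivWithinAt_along (dif hf) hd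
  have hco := fun P hP => contDiffAt_coeffs hc (hΔ P hP)
  have cB := hsol.contDiffOn_coeff fun P hP => (hco P hP).1
  have cC := hsol.contDiffOn_coeff fun P hP => (hco P hP).2.1
  have cE := hsol.contDiffOn_coeff fun P hP => (hco P hP).2.2.2
  obtain ⟨dB, dC, -, dE⟩ := hco P hmem
  have hf : ContDiffOn ℝ 1 (fun P => (c.C (jet z p q P) + c.Delta (jet z p q P)) / 2
      - c.B (jet z p q P) * u₁ P) T :=
    ((cC.add cE).div_const 2).sub (cB.mul hsol.contDiffOn_u₁)
  have hfy := (hasDerivAt_dy (dif hf)).unique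
      ((((hasDerivAt_dy (dif cC)).add (hasDerivAt_dy (dif cE))).div_const 2).sub
        ((hasDerivAt_dy (dif cB)).mul (hasDerivAt_dy (dif hsol.contDiffOn_u₁))))
  have hq := hasDerivWithinAt_dy_along hT hsol.contDiffOn_u₁ hsol.contDiffOn_q hf
    (fun P hP => hsol.eq_q P hP _ rfl) hg ht
  rw [← hP, hfy] at hq
  have h := (along cE).sub (((along hsol.contDiffOn_u₁).sub (along hsol.contDiffOn_u₂)).mul
    (hq.add (along cB)))
  refine h.congr_deriv ?_
  have key := defect_identity₁ (hΔ P hmem).ne' (hsol.eq_u₁ P hmem _ rfl) (hsol.eq_u₂ P hmem _ rfl)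
    (hsol.eq_z P hmem) (hsol.eq_p P hmem _ rfl) (hsol.eq_q P hmem _ rfl)
  have two : (2 : WithTop ℕ∞) ≠ 0 := two_ne_zero
  have dz := dif hsol.contDiffOn_z
  have dp := dif hsol.contDiffOn_p
  have dq := dif hsol.contDiffOn_q
  rw [dx_comp_jet (dB.differentiableAt two) dz dp dq,
    dy_comp_jet (dB.differentiableAt two) dz dp dq,
    dy_comp_jet (dC.differentiableAt two) dz dp dq,
    dx_comp_jet (dE.differentiableAt two) dz dp dq, dy_comp_jet (dE.differentiableAt two) dz dp dq]
  subst hw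
  subst hP
  exact key

/-- The characteristic derivative of `(u₁ - u₂) p_y + (C + Δ) / 2 u₂ - (C - Δ) / 2 u₁`. -/
lemma IsRiemannSolution.hasDerivWithinAt_defectP (hT : IsOpen T) (hc : c.IsC2)
    (hsol : c.IsRiemannSolution T u₁ u₂ z p q) (hΔ : ∀ P ∈ T, 0 < c.Delta (jet z p q P))
    {a b : ℝ} {g : ℝ → ℝ} (hg : IsChar T u₂ a b g) {t : ℝ} (ht : t ∈ Icc a b) {P : ℝ × ℝ}
    (hP : P = (t, g t)) {w : Fin 5 → ℝ} (hw : w = jet z p q P) :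
    HasDerivWithinAt (fun s => c.defectP u₁ u₂ z p q (s, g s))
      ((u₁ P - u₂ P) * (u₁ P * ((pd 2 c.C w - pd 2 c.Delta w) / 2) - pd 2 c.D w)
          * defectZ z q P
        + (pd 4 c.D w - u₁ P * ((pd 4 c.C w - pd 4 c.Delta w) / 2))
          * c.defectQ u₁ u₂ z p q P
        + (c.rhsQuot w (u₁ P) (u₂ P) + u₂ P * ((pd 3 c.C w + pd 3 c.Delta w) / 2) - pd 3 c.D w)
          * c.defectP u₁ u₂ z p q P) (Icc a b) t := by
  obtain ⟨hmem, hd⟩ := hg t ht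
  rw [← hP] at hmem hd
  have dif : ∀ {f : ℝ × ℝ → ℝ}, ContDiffOn ℝ 1 f T → DifferentiableAt ℝ f P := fun hf =>
    differentiableAt_of_contDiffOn hT hf one_ne_zero hmem
  have along : ∀ {f : ℝ × ℝ → ℝ}, ContDiffOn ℝ 1 f T →
      HasDerivWithinAt (fun s => f (s, g s)) (dx f P + u₂ P * dy f P) (Icc a b) t := fun hf => by
    subst hP; exact hasDerivWithinAt_along (dif hf) hd
  have hco := fun P hP => contDiffAt_coeffs hc (hΔ P hP)
  have cC := hsol.contDiffOn_coeff fun P hP => (hco P hP).2.1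
  have cD := hsol.contDiffOn_coeff fun P hP => (hco P hP).2.2.1
  have cE := hsol.contDiffOn_coeff fun P hP => (hco P hP).2.2.2
  obtain ⟨-, dC, dD, dE⟩ := hco P hmem
  have hf : ContDiffOn ℝ 1 (fun P => (c.C (jet z p q P) + c.Delta (jet z p q P)) / 2 * u₂ P
      - c.D (jet z p q P)) T :=
    (((cC.add cE).div_const 2).mul hsol.contDiffOn_u₂).sub cD
  have hfy := (hasDerivAt_dy (dif hf)).unique
      (((((hasDerivAt_dy (dif cC)).add (hasDerivAt_dy (dif cE))).div_const 2).mul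
        (hasDerivAt_dy (dif hsol.contDiffOn_u₂))).sub (hasDerivAt_dy (dif cD)))
  have hp := hasDerivWithinAt_dy_along hT hsol.contDiffOn_u₂ hsol.contDiffOn_p hf
    (fun P hP => hsol.eq_p P hP _ rfl) hg ht
  rw [← hP, hfy] at hp
  have h := ((((along hsol.contDiffOn_u₁).sub (along hsol.contDiffOn_u₂)).mul hp).add
    ((((along cC).add (along cE)).div_const 2).mul (along hsol.contDiffOn_u₂))).sub
    ((((along cC).sub (along cE)).div_const 2).mul (along hsol.contDiffOn_u₁))
  refine h.congr_deriv ?_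
  have key := defect_identity₂ (hΔ P hmem).ne' (hsol.eq_u₁ P hmem _ rfl) (hsol.eq_u₂ P hmem _ rfl)
    (hsol.eq_z P hmem) (hsol.eq_p P hmem _ rfl) (hsol.eq_q P hmem _ rfl)
  have two : (2 : WithTop ℕ∞) ≠ 0 := two_ne_zero
  have dz := dif hsol.contDiffOn_z
  have dp := dif hsol.contDiffOn_p
  have dq := dif hsol.contDiffOn_q
  rw [dy_comp_jet (dD.differentiableAt two) dz dp dq,
    dx_comp_jet (dC.differentiableAt two) dz dp dq,
    dy_comp_jet (dC.differentiableAt two) dz dp dq,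
    dx_comp_jet (dE.differentiableAt two) dz dp dq, dy_comp_jet (dE.differentiableAt two) dz dp dq]
  subst hw
  subst hP
  refine Eq.trans ?_ key
  simp only [Pi.add_apply, Pi.sub_apply, jet]

end Solution

end Coeffs

/-! ### Vanishing of the defects -/

section Bounds

variable {T : Set (ℝ × ℝ)}

/-- A function whose characteristic derivative is a linear combination of `φ`, `χ`, `ψ` with
continuous coefficients is transported with a linear bound. -/
lemma exists_isTransported {u Φ φ χ ψ k₁ k₂ k₃ : ℝ × ℝ → ℝ} (h₁ : ContinuousOn k₁ T)
    (h₂ : ContinuousOn k₂ T) (h₃ : ContinuousOn k₃ T)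
    (hd : ∀ a b g, IsChar T u a b g → ∀ t ∈ Icc a b,
      HasDerivWithinAt (fun s => Φ (s, g s)) (k₁ (t, g t) * φ (t, g t)
        + k₂ (t, g t) * χ (t, g t) + k₃ (t, g t) * ψ (t, g t)) (Icc a b) t) :
    ∃ A : ℝ × ℝ → ℝ, ContinuousOn A T ∧ (∀ P, 0 ≤ A P) ∧
      IsTransported T u Φ fun P => A P * (‖(φ P, χ P)‖ + ‖ψ P‖) := by
  refine ⟨fun P => |k₁ P| + |k₂ P| + |k₃ P|, (h₁.abs.add h₂.abs).add h₃.abs,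
    fun P => by positivity, fun a b g hg t ht => ⟨_, hd a b g hg t ht, ?_⟩⟩
  generalize (t, g t) = P
  have e₁ : |φ P| ≤ ‖(φ P, χ P)‖ + ‖ψ P‖ := by
    linarith [norm_fst_le (φ P, χ P), norm_nonneg (ψ P), Real.norm_eq_abs (φ P)]
  have e₂ : |χ P| ≤ ‖(φ P, χ P)‖ + ‖ψ P‖ := by
    linarith [norm_snd_le (φ P, χ P), norm_nonneg (ψ P), Real.norm_eq_abs (χ P)]
  have e₃ : |ψ P| ≤ ‖(φ P, χ P)‖ + ‖ψ P‖ := by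
    linarith [norm_nonneg (φ P, χ P), Real.norm_eq_abs (ψ P)]
  calc ‖k₁ P * φ P + k₂ P * χ P + k₃ P * ψ P‖
      ≤ |k₁ P| * |φ P| + |k₂ P| * |χ P| + |k₃ P| * |ψ P| := by
        simpa only [Real.norm_eq_abs, abs_mul] using
          norm_add₃_le (a := k₁ P * φ P) (b := k₂ P * χ P) (c := k₃ P * ψ P)
    _ ≤ |k₁ P| * (‖(φ P, χ P)‖ + ‖ψ P‖) + |k₂ P| * (‖(φ P, χ P)‖ + ‖ψ P‖)
        + |k₃ P| * (‖(φ P, χ P)‖ + ‖ψ P‖) := by gcongr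
    _ = _ := by ring

lemma IsTransported.mono {E : Type*} [NormedAddCommGroup E] [NormedSpace ℝ E] {u : ℝ × ℝ → ℝ}
    {Φ : ℝ × ℝ → E} {r r' : ℝ × ℝ → ℝ} (h : IsTransported T u Φ r) (hr : ∀ P, r P ≤ r' P) :
    IsTransported T u Φ r' := fun a b g hg t ht =>
  let ⟨d, hd, hdr⟩ := h a b g hg t ht
  ⟨d, hd, hdr.trans (hr _)⟩

lemma IsTransported.prodMk {u φ χ r : ℝ × ℝ → ℝ} (h₁ : IsTransported T u φ r)
    (h₂ : IsTransported T u χ r) : IsTransported T u (fun P => (φ P, χ P)) r :=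
  fun a b g hg t ht =>
    let ⟨d₁, hd₁, hr₁⟩ := h₁ a b g hg t ht
    let ⟨d₂, hd₂, hr₂⟩ := h₂ a b g hg t ht
    ⟨(d₁, d₂), hd₁.prodMk hd₂, max_le hr₁ hr₂⟩

/-- On the axis the `y`-derivative is determined by the initial values. -/
lemma dy_axis (hT : IsOpen T) {f : ℝ × ℝ → ℝ} {f₀ : ℝ → ℝ} {y : ℝ} (hy : ((0 : ℝ), y) ∈ T)
    (hf : ContDiffOn ℝ 1 f T) (heq : ∀ y, (0, y) ∈ T → f (0, y) = f₀ y) :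
    dy f (0, y) = deriv f₀ y := by
  have h := hasDerivAt_dy (differentiableAt_of_contDiffOn hT hf one_ne_zero hy)
  have hev : ∀ᶠ s in 𝓝 y, ((0 : ℝ), s) ∈ T :=
    (Continuous.prodMk_right (0 : ℝ)).continuousAt.eventually (hT.mem_nhds hy)
  exact (h.congr_of_eventuallyEq (hev.mono fun s hs => (heq s hs).symm)).deriv.symm

end Bounds

namespace Coeffs

section Solution

variable {c : Coeffs} {T : Set (ℝ × ℝ)} {u₁ u₂ z p q : ℝ × ℝ → ℝ} {z₀ p₀ : ℝ → ℝ}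

lemma HasInitialValues.jet_axis (hinit : c.HasInitialValues z₀ p₀ T u₁ u₂ z p q) {y : ℝ}
    (hy : ((0 : ℝ), y) ∈ T) : jet z p q (0, y) = initPt z₀ p₀ y := by
  simp only [jet, initPt, hinit.z_eq y hy, hinit.p_eq y hy, hinit.q_eq y hy]

/-- On the axis the defect of `(u₁ - u₂) (q_y + B) = Δ` vanishes. -/
lemma HasInitialValues.sub_mul_axis (hdata : c.IsCauchyData z₀ p₀)
    (hinit : c.HasInitialValues z₀ p₀ T u₁ u₂ z p q) {y : ℝ} (hy : ((0 : ℝ), y) ∈ T) :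
    (u₁ (0, y) - u₂ (0, y)) * (deriv (deriv z₀) y + c.B (initPt z₀ p₀ y)) =
      c.Delta (initPt z₀ p₀ y) := by
  have hm := hdata.free y
  rw [hinit.u₁_eq y hy, hinit.u₂_eq y hy]
  field_simp
  ring

lemma HasInitialValues.slopes_ne_axis (hdata : c.IsCauchyData z₀ p₀)
    (hinit : c.HasInitialValues z₀ p₀ T u₁ u₂ z p q) {y : ℝ} (hy : ((0 : ℝ), y) ∈ T) :
    u₁ (0, y) ≠ u₂ (0, y) := by
  intro h
  have h1 := hinit.sub_mul_axis hdata hy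
  have h2 : 0 < c.Delta (initPt z₀ p₀ y) := Real.sqrt_pos.2 (hdata.hyperbolic y)
  rw [h, sub_self, zero_mul] at h1
  exact h2.ne h1

lemma defects_axis (hT : IsOpen T) (hdata : c.IsCauchyData z₀ p₀)
    (hsol : c.IsRiemannSolution T u₁ u₂ z p q)
    (hinit : c.HasInitialValues z₀ p₀ T u₁ u₂ z p q) {y : ℝ} (hy : ((0 : ℝ), y) ∈ T) :
    defectZ z q (0, y) = 0 ∧ c.defectQ u₁ u₂ z p q (0, y) = 0 ∧
      c.defectP u₁ u₂ z p q (0, y) = 0 := by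
  have hm := hdata.free y
  refine ⟨?_, ?_, ?_⟩
  · rw [defectZ, dy_axis hT hy hsol.contDiffOn_z hinit.z_eq, hinit.q_eq y hy, sub_self]
  · rw [defectQ, dy_axis hT hy hsol.contDiffOn_q hinit.q_eq, hinit.jet_axis hy,
      hinit.sub_mul_axis hdata hy, sub_self]
  · rw [defectP, dy_axis hT hy hsol.contDiffOn_p hinit.p_eq, hinit.jet_axis hy,
      hinit.u₁_eq y hy, hinit.u₂_eq y hy]
    field_simp
    ring

/-- The defects of a solution with admissible initial values vanish on a domain of determinacy. -/
lemma defects_eq_zero (hc : c.IsC2) (hdata : c.IsCauchyData z₀ p₀) (hT : IsOpen T)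
    (hTc : IsPreconnected T) (hsol : c.IsRiemannSolution T u₁ u₂ z p q)
    (hinit : c.HasInitialValues z₀ p₀ T u₁ u₂ z p q) (hdet : IsDomainOfDeterminacy T u₁ u₂)
    (hΔ : ∀ P ∈ T, 0 < c.Delta (jet z p q P)) (hne : ∀ P ∈ T, u₁ P ≠ u₂ P) {P : ℝ × ℝ}
    (hP : P ∈ T) :
    defectZ z q P = 0 ∧ c.defectQ u₁ u₂ z p q P = 0 ∧ c.defectP u₁ u₂ z p q P = 0 := by
  have hco := fun P hP => contDiffAt_coeffs hc (hΔ P hP)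
  have cB := hsol.contDiffOn_coeff fun P hP => (hco P hP).1
  have cC := hsol.contDiffOn_coeff fun P hP => (hco P hP).2.1
  have cE := hsol.contDiffOn_coeff fun P hP => (hco P hP).2.2.2
  have b := hsol.continuousOn_pd fun P hP => (hco P hP).1
  have k := hsol.continuousOn_pd fun P hP => (hco P hP).2.1
  have d := hsol.continuousOn_pd fun P hP => (hco P hP).2.2.1
  have e := hsol.continuousOn_pd fun P hP => (hco P hP).2.2.2
  have hr := hsol.continuousOn_rhsQuot hc hΔ
  have v₁ := hsol.contDiffOn_u₁.continuousOn
  have v₂ := hsol.contDiffOn_u₂.continuousOn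
  have hs := v₁.sub v₂
  have hs0 : ∀ P ∈ T, u₁ P - u₂ P ≠ 0 := fun P hP => sub_ne_zero.2 (hne P hP)
  obtain ⟨A₁, hA₁, pos₁, t₁⟩ := exists_isTransported (u := u₁) (Φ := defectZ z q)
    (continuousOn_dy hT hsol.contDiffOn_u₁).neg (v₁.div hs hs0).neg
    (continuousOn_const.div hs hs0) fun a b g hg t ht =>
      hsol.hasDerivWithinAt_defectZ hT hne hg ht
  obtain ⟨A₂, hA₂, pos₂, t₂⟩ := exists_isTransported (u := u₁) (Φ := c.defectQ u₁ u₂ z p q)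
    (hs.mul ((((k 2).add (e 2)).div_const 2).sub (v₁.mul (b 2)))).neg
    ((hr.add (((k 4).add (e 4)).div_const 2)).sub (v₁.mul (b 4)))
    (((e 3).sub (((k 3).add (e 3)).div_const 2)).add (v₂.mul (b 3))) fun a b g hg t ht =>
      hsol.hasDerivWithinAt_defectQ hT hc hΔ hg ht rfl rfl
  obtain ⟨A₃, hA₃, pos₃, t₃⟩ := exists_isTransported (u := u₂) (Φ := c.defectP u₁ u₂ z p q)
    (hs.mul ((v₁.mul (((k 2).sub (e 2)).div_const 2)).sub (d 2)))
    ((d 4).sub (v₁.mul (((k 4).sub (e 4)).div_const 2)))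
    ((hr.add (v₂.mul (((k 3).add (e 3)).div_const 2))).sub (d 3)) fun a b g hg t ht =>
      hsol.hasDerivWithinAt_defectP hT hc hΔ hg ht rfl rfl
  have cz : ContinuousOn (defectZ z q) T :=
    (continuousOn_dy hT hsol.contDiffOn_z).sub hsol.contDiffOn_q.continuousOn
  have cq : ContinuousOn (c.defectQ u₁ u₂ z p q) T := cE.continuousOn.sub
    (hs.mul ((continuousOn_dy hT hsol.contDiffOn_q).add cB.continuousOn))
  have cp : ContinuousOn (c.defectP u₁ u₂ z p q) T :=
    ((hs.mul (continuousOn_dy hT hsol.contDiffOn_p)).add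
      (((cC.add cE).div_const 2).continuousOn.mul v₂)).sub
      (((cC.sub cE).div_const 2).continuousOn.mul v₁)
  have hax := fun y (hy : ((0 : ℝ), y) ∈ T) => defects_axis hT hdata hsol hinit hy
  have mono : ∀ {B : ℝ × ℝ → ℝ}, (∀ P, B P ≤ A₁ P + A₂ P + A₃ P) → ∀ P,
      B P * (‖(defectZ z q P, c.defectQ u₁ u₂ z p q P)‖ + ‖c.defectP u₁ u₂ z p q P‖) ≤
      (A₁ P + A₂ P + A₃ P) *
        (‖(defectZ z q P, c.defectQ u₁ u₂ z p q P)‖ + ‖c.defectP u₁ u₂ z p q P‖) :=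
    fun hB P => mul_le_mul_of_nonneg_right (hB P) (by positivity)
  have key := eq_zero_of_isTransported
    (Φ₁ := fun P => (defectZ z q P, c.defectQ u₁ u₂ z p q P)) (Φ₂ := c.defectP u₁ u₂ z p q)
    hT hTc hsol.contDiffOn_u₁ hsol.contDiffOn_u₂ hne hdet ((hA₁.add hA₂).add hA₃)
    (cz.prodMk cq) cp
    ((t₁.mono (mono fun P => by linarith [pos₁ P, pos₂ P, pos₃ P])).prodMk
      (t₂.mono (mono fun P => by linarith [pos₁ P, pos₂ P, pos₃ P])))
    (t₃.mono (mono fun P => by linarith [pos₁ P, pos₂ P, pos₃ P]))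
    (fun y hy => by simp only [(hax y hy).1, (hax y hy).2.1]; rfl)
    (fun y hy => (hax y hy).2.2) hP
  exact ⟨(Prod.mk.inj key.1).1, (Prod.mk.inj key.1).2, key.2⟩

/-- The Monge–Ampère expression vanishes when the second derivatives are expressed through the
slopes of the characteristics. -/
lemma equation_of_slopes {w : Fin 5 → ℝ} (hw : 0 ≤ c.disc w) {s₁ s₂ px py qy : ℝ}
    (hq : (s₁ - s₂) * (qy + c.B w) = c.Delta w)
    (hpy : py = (c.C w + c.Delta w) / 2 - s₁ * (qy + c.B w))
    (hpx : px + s₂ * py = (c.C w + c.Delta w) / 2 * s₂ - c.D w) :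
    c.A w + c.B w * px + c.C w * py + c.D w * qy + (px * qy - py ^ 2) = 0 := by
  have hsq : c.Delta w ^ 2 = c.C w ^ 2 - 4 * c.B w * c.D w + 4 * c.A w := Real.sq_sqrt hw
  obtain rfl : px = (c.C w + c.Delta w) / 2 * s₂ - c.D w - s₂ * py := by linarith
  subst hpy
  linear_combination -s₁ * (qy + c.B w) * hq - hsq / 4

end Solution

end Coeffs

end MongeAmpere

open MongeAmpere MongeAmpere.Coeffs in
theorem mainTheorem2 (c : MongeAmpere.Coeffs) (hc : c.IsC2)
    (z₀ p₀ : ℝ → ℝ) (hdata : c.IsCauchyData z₀ p₀)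
    (T : Set (ℝ × ℝ)) (hTopen : IsOpen T) (hTconn : IsConnected T)
    (hTaxis : ∃ y : ℝ, ((0 : ℝ), y) ∈ T)
    (u₁ u₂ z p q : ℝ × ℝ → ℝ)
    (hsol : c.IsRiemannSolution T u₁ u₂ z p q)
    (hinit : c.HasInitialValues z₀ p₀ T u₁ u₂ z p q)
    (hdet : MongeAmpere.IsDomainOfDeterminacy T u₁ u₂)
    (hDelta : ∀ P ∈ T, 0 < c.Delta (MongeAmpere.pt P.1 P.2 (z P) (p P) (q P))) :
    c.IsCauchySolution z₀ p₀ T z ∧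
      (∀ P ∈ T, MongeAmpere.dx z P = p P ∧ MongeAmpere.dy z P = q P) ∧
      (∀ P ∈ T, u₁ P ≠ u₂ P) ∧
      (∀ P ∈ T, MongeAmpere.dy (MongeAmpere.dy z) P
        + c.B (MongeAmpere.pt P.1 P.2 (z P) (MongeAmpere.dx z P) (MongeAmpere.dy z P)) ≠ 0) := by
  have hΔ : ∀ P ∈ T, 0 < c.Delta (jet z p q P) := hDelta
  have hne : ∀ P ∈ T, u₁ P ≠ u₂ P := fun P hP =>
    hsol.slopes_ne hTopen hc hΔ hdet.1 (fun y hy => hinit.slopes_ne_axis hdata hy) hP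
  have hs0 : ∀ P ∈ T, u₁ P - u₂ P ≠ 0 := fun P hP => sub_ne_zero.2 (hne P hP)
  have hdef := fun P (hP : P ∈ T) =>
    defects_eq_zero hc hdata hTopen hTconn.isPreconnected hsol hinit hdet hΔ hne hP
  have hzy : ∀ P ∈ T, dy z P = q P := fun P hP => sub_eq_zero.1 (hdef P hP).1
  have hzx : ∀ P ∈ T, dx z P = p P := fun P hP => by
    have := hsol.eq_z P hP
    rw [hzy P hP] at this
    linarith
  have hqm : ∀ P ∈ T, (u₁ P - u₂ P) * (dy q P + c.B (jet z p q P)) = c.Delta (jet z p q P) :=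
    fun P hP => (sub_eq_zero.1 (hdef P hP).2.1).symm
  have hqy : ∀ P ∈ T, dy q P = c.Delta (jet z p q P) / (u₁ P - u₂ P) - c.B (jet z p q P) :=
    fun P hP => by rw [eq_sub_iff_add_eq, eq_div_iff (hs0 P hP), mul_comm]; exact hqm P hP
  have hpy : ∀ P ∈ T, dy p P = (c.C (jet z p q P) + c.Delta (jet z p q P)) / 2
      - u₁ P * (dy q P + c.B (jet z p q P)) := fun P hP => by
    have h1 : (u₁ P - u₂ P) * dy p P + (c.C (jet z p q P) + c.Delta (jet z p q P)) / 2 * u₂ P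
      - (c.C (jet z p q P) - c.Delta (jet z p q P)) / 2 * u₁ P = 0 := (hdef P hP).2.2
    refine mul_left_cancel₀ (hs0 P hP) ?_
    linear_combination h1 + u₁ P * hqm P hP
  have hqx : ∀ P ∈ T, dx q P = dy p P := fun P hP => by
    have := hsol.eq_q P hP _ rfl
    rw [hpy P hP]
    simp only [jet] at this ⊢
    linear_combination this
  have hpx : ∀ P ∈ T, dx p P + u₂ P * dy p P
      = (c.C (jet z p q P) + c.Delta (jet z p q P)) / 2 * u₂ P - c.D (jet z p q P) :=
    fun P hP => hsol.eq_p P hP _ rfl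
  -- the first derivatives of `p` and `q` are of class `C¹`, so `p` and `q` are of class `C²`
  have hco := fun P hP => contDiffAt_coeffs hc (hΔ P hP)
  have cB := hsol.contDiffOn_coeff fun P hP => (hco P hP).1
  have cC := hsol.contDiffOn_coeff fun P hP => (hco P hP).2.1
  have cD := hsol.contDiffOn_coeff fun P hP => (hco P hP).2.2.1
  have cE := hsol.contDiffOn_coeff fun P hP => (hco P hP).2.2.2
  have cu₁ := hsol.contDiffOn_u₁
  have cu₂ := hsol.contDiffOn_u₂
  have cqy : ContDiffOn ℝ 1 (dy q) T := ((cE.div (cu₁.sub cu₂) hs0).sub cB).congr hqy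
  have cpy : ContDiffOn ℝ 1 (dy p) T :=
    (((cC.add cE).div_const 2).sub (cu₁.mul (cqy.add cB))).congr hpy
  have cpx : ContDiffOn ℝ 1 (dx p) T :=
    (((((cC.add cE).div_const 2).mul cu₂).sub cD).sub (cu₂.mul cpy)).congr
      fun P hP => eq_sub_of_add_eq (hpx P hP)
  have dif : ∀ {f : ℝ × ℝ → ℝ}, ContDiffOn ℝ 1 f T → ∀ P ∈ T, DifferentiableAt ℝ f P :=
    fun hf P hP => differentiableAt_of_contDiffOn hTopen hf one_ne_zero hP
  have cp : ContDiffOn ℝ 2 p T := by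
    have := contDiffOn_succ_of_dx_dy (n := 1) hTopen (dif hsol.contDiffOn_p) cpx cpy
      (fun _ _ => rfl) fun _ _ => rfl
    simpa [one_add_one_eq_two] using this
  have cq : ContDiffOn ℝ 2 q T := by
    have := contDiffOn_succ_of_dx_dy (n := 1) hTopen (dif hsol.contDiffOn_q) cpy cqy
      hqx fun _ _ => rfl
    simpa [one_add_one_eq_two] using this
  have cz : ContDiffOn ℝ 3 z T := by
    have := contDiffOn_succ_of_dx_dy (n := 2) hTopen (dif hsol.contDiffOn_z) cp cq hzx hzy
    simpa [two_add_one_eq_three] using this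
  have ev : ∀ {f g : ℝ × ℝ → ℝ}, (∀ P ∈ T, f P = g P) → ∀ P ∈ T, fderiv ℝ f P = fderiv ℝ g P :=
    fun h P hP => (Filter.eventuallyEq_of_mem (hTopen.mem_nhds hP) h).fderiv_eq
  have hjet : ∀ P ∈ T, pt P.1 P.2 (z P) (dx z P) (dy z P) = jet z p q P := fun P hP => by
    rw [hzx P hP, hzy P hP]; rfl
  have hzxx : ∀ P ∈ T, dx (dx z) P = dx p P := fun P hP => by rw [dx, ev hzx P hP, dx]
  have hzxy : ∀ P ∈ T, dy (dx z) P = dy p P := fun P hP => by rw [dy, ev hzx P hP, dy]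
  have hzyy : ∀ P ∈ T, dy (dy z) P = dy q P := fun P hP => by rw [dy, ev hzy P hP, dy]
  refine ⟨⟨cz, ?_, ?_, hinit.z_eq, ?_⟩, fun P hP => ⟨hzx P hP, hzy P hP⟩, hne, ?_⟩
  · intro P hP w hw
    rw [hjet P hP] at hw
    subst hw
    rw [hzxx P hP, hzxy P hP, hzyy P hP]
    exact equation_of_slopes (disc_pos_of_delta_pos (hΔ P hP)).le (hqm P hP) (hpy P hP) (hpx P hP)
  · intro P hP
    rw [hjet P hP]
    exact disc_pos_of_delta_pos (hΔ P hP)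
  · intro y hy
    rw [hzx _ hy]
    exact hinit.p_eq y hy
  · intro P hP h0
    rw [hjet P hP, hzyy P hP] at h0
    have := hqm P hP
    rw [h0, mul_zero] at this
    exact (hΔ P hP).ne this
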